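/- **Setting.** Let $N\ge 2$. An entire $N\times N$ matrix-valued function $M$ belongs to $\mathscr M_N$ if $M(z)JM^*(\bar z)=J$ for all $z\in\mathbb C$ for some unitary matrix $J$, and every eigenvalue $\tau$ of $M(z)$ with $|\tau|=1$ forces $z\in\mathbb R$. Let $\tau_1(z),\dots,\tau_N(z)$ be the eigenvalues of $M(z)$ with multiplicity and $\Delta_j=\frac12(\tau_j+\tau_j^{-1})$. The function $M\in\mathscr M_N$ belongs to $\mathscr M_N^0$ if $\Delta_j(z)=\cos z+o(e^{|\operatorname{Im}z|})$ as $|z|\to\infty$ for each $j$. The set $\{1,\dots,N\}$ is the disjoint union of sets $\omega_1,\dots,\omega_{N_0}$ such that $\Delta_j$, $j\in\omega_s$, are all the branches of one analytic function on a connected $N_s$-sheeted Riemann surface, $N_s=\#\omega_s$; equivalently, $\Phi_s(\nu,z)=\prod_{j\in\omega_s}(\nu-\Delta_j(z))$ is a polynomial in $\nu$ with entire coefficients that is irreducible over the ring of entire functions. Put $\rho_s=\prod_{j<k;\ j,k\in\omega_s}(\Delta_j-\Delta_k)^2$ and $c_s=\prod_{j<k;\ j,k\in\omega_s}(b_j-b_k)^2$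 (an empty product is $1$). The Cartwright class $\mathcal E_C(a_+,a_-)$ consists of the entire functions $f$ of exponential type with $\int_{\mathbb R}\frac{\log^+|f(x)|}{1+x^2}\,dx<\infty$ and $\limsup_{y\to+\infty}\frac{\log|f(\pm iy)|}{y}=a_\pm$. **Lemma.** Let $M\in\mathscr M_N^0$, let $s\in\{1,\dots,N_0\}$, and let $b_j$, $j\in\omega_s$, be pairwise distinct constants with $$\Delta_j(z)=\cos z+\frac{b_j\sin z+o(e^{|\operatorname{Im}z|})}{2z}\qquad(j\in\omega_s)\tag{1}$$ as $\operatorname{Im}z\to+\infty$. Then $\rho_s\in\mathcal E_C(a,a)$ with $a=N_s(N_s-1)$, and $$\rho_s(z)=c_s\Big(\frac{\sin z}{2z}\Big)^{N_s(N_s-1)}(1+o(1))\quad\text{as }\operatorname{Im}z\to+\infty .$$ Let in addition (1) hold as $|z|\to\infty$. Then: i) There is an integer $n_0\ge1$ such that $\rho_s$ has exactly $2N_s(N_s-1)n_0$ zeros, counted with multiplicity, in the disc $\{|z|<\pi(n_0+\frac12)\}$ and, for each integer $n$ with $|n|>n_0$, exactly $N_s(N_s-1)$ zeros, counted with multiplicity,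 in $\{|z-\pi n|<\frac\pi2\}$; there are no other zeros. Moreover, $$\rho_s(z)=c_s\Big(\frac{\sin z+o(e^{|\operatorname{Im}z|})}{2z}\Big)^{N_s(N_s-1)}\quad\text{as }|z|\to\infty .$$ ii) The zeros of $\rho_s$, counted with multiplicity, can be labelled $z_\alpha^{n\pm}$ with $\alpha=(j,k)$, $j<k$, $j,k\in\omega_s$, and $n\in\mathbb Z\setminus\{0\}$, so that $z_\alpha^{n\pm}=\pi n+o(1)$ as $n\to\pm\infty$. iii) If in addition, for each $j\in\omega_s$, $\Delta_j(z)=\cos\big(z-\frac{b_j}{2z}\big)+o(n^{-2})$ uniformly in $|z-\pi n|\le1$ as $n\to\pm\infty$, then the labelling in ii) can be chosen so that, moreover, $$z_\alpha^{n\pm}=\pi n+\frac{b_j+b_k+o(1)}{4\pi n},\qquad \alpha=(j,k),\ n\to\pm\infty .$$ -/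

import Mathlib

open Filter Topology Asymptotics Polynomial

/-- The class `𝓜_N` of monodromy matrices: entire `N × N` matrix functions with
`M(z) J M(z̄)* = J` for some unitary `J`, whose eigenvalues (multipliers) can have modulus one
only for real `z`. -/
structure IsMonodromy {N : ℕ} (M : ℂ → Matrix (Fin N) (Fin N) ℂ) : Prop where
  entire : ∀ i j, Differentiable ℂ fun z => M z i j
  unitary : ∃ J ∈ Matrix.unitaryGroup (Fin N) ℂ,
    ∀ z : ℂ, M z * J * (M (starRingEnd ℂ z)).conjTranspose = J
  multiplier_real : ∀ z τ : ℂ, (M z).charpoly.IsRoot τ → ‖τ‖ = 1 → z.im = 0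

/-- The class `𝓜_N⁰`: moreover `(τ + τ⁻¹)/2 = cos z + o(e^{|Im z|})` as `|z| → ∞`, for all the
multipliers `τ` of `M(z)`. -/
structure IsMonodromyZero {N : ℕ} (M : ℂ → Matrix (Fin N) (Fin N) ℂ) : Prop
    extends IsMonodromy M where
  cos_asymp : ∀ δ > 0, ∀ᶠ z in cocompact ℂ, ∀ τ : ℂ, (M z).charpoly.IsRoot τ →
    ‖(τ + τ⁻¹) / 2 - Complex.cos z‖ ≤ δ * Real.exp |z.im|

/-- The ring of entire functions. -/
def entireFunctions : Subring (ℂ → ℂ) where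
  carrier := {f | Differentiable ℂ f}
  mul_mem' hf hg := Differentiable.mul hf hg
  one_mem' := differentiable_const 1
  add_mem' hf hg := Differentiable.add hf hg
  zero_mem' := differentiable_const 0
  neg_mem' hf := Differentiable.neg hf

/-- Evaluation of entire functions at a point. -/
def entireFunctions.evalAt (z : ℂ) : entireFunctions →+* ℂ :=
  (Pi.evalRingHom (fun _ : ℂ => ℂ) z).comp entireFunctions.subtype

/-- The Lyapunov function `Δ_j = (τ_j + τ_j⁻¹)/2`. -/
noncomputable def lyapunov {N : ℕ} (τ : Fin N → ℂ → ℂ) (j : Fin N) (z : ℂ) : ℂ :=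
  (τ j z + (τ j z)⁻¹) / 2

/-- `τ_1, …, τ_N` enumerate the multipliers of `M` with multiplicity at each point, and `ω` is the
partition of the index set such that the `Δ_j`, `j ∈ ω_s`, are all the branches of one analytic
function on a connected Riemann surface spread over the plane. The latter is expressed
algebraically: `Φ_s(ν, z) = ∏_{j ∈ ω_s} (ν - Δ_j(z))` is a polynomial in `ν` with entire
coefficients, irreducible over the ring of entire functions (the roots of a polynomial with
analytic coefficients are the branches of one analytic function on a connected surface exactly when
the polynomial is irreducible). Neither continuity nor a choice of cuts is imposed on the labelling
of the roots. -/
structure IsLyapunovDecomposition {N N₀ : ℕ} (M : ℂ → Matrix (Fin N) (Fin N) ℂ)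
    (τ : Fin N → ℂ → ℂ) (ω : Fin N₀ → Finset (Fin N))
    (Φ : Fin N₀ → Polynomial entireFunctions) : Prop where
  multipliers : ∀ z, (M z).charpoly = ∏ j, (X - C (τ j z))
  disjoint : ∀ s t, s ≠ t → Disjoint (ω s) (ω t)
  cover : ∀ j, ∃ s, j ∈ ω s
  branches : ∀ s z, (Φ s).map (entireFunctions.evalAt z) =
    ∏ j ∈ ω s, (X - C (lyapunov τ j z))
  irreducible : ∀ s, Irreducible (Φ s)

/-- The pairs `α = (j, k)` with `j < k` and `j, k ∈ ω`. -/
def orderedPairs {N : ℕ} (ω : Finset (Fin N)) : Finset (Fin N × Fin N) :=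
  (ω ×ˢ ω).filter fun p => p.1 < p.2

/-- `ρ_s = ∏_{j < k; j, k ∈ ω_s} (Δ_j - Δ_k)²`. -/
noncomputable def resonanceFun {N : ℕ} (τ : Fin N → ℂ → ℂ) (ω : Finset (Fin N)) (z : ℂ) : ℂ :=
  ∏ p ∈ orderedPairs ω, (lyapunov τ p.1 z - lyapunov τ p.2 z) ^ 2

/-- `c_s = ∏_{j < k; j, k ∈ ω_s} (b_j - b_k)²`. -/
noncomputable def resonanceConst {N : ℕ} (b : Fin N → ℂ) (ω : Finset (Fin N)) : ℂ :=
  ∏ p ∈ orderedPairs ω, (b p.1 - b p.2) ^ 2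

/-- The filter `Im z → +∞` (uniformly in `Re z`). -/
def imAtTop : Filter ℂ := comap Complex.im atTop

/-- `Δ(z) = cos z + (b sin z + o(e^{|Im z|})) / (2z)` along the filter `l`. -/
def HasLyapunovAsymptotics (l : Filter ℂ) (Δ : ℂ → ℂ) (b : ℂ) : Prop :=
  ∃ ε : ℂ → ℂ, ε =o[l] (fun z => Real.exp |z.im|) ∧
    ∀ᶠ z in l, Δ z = Complex.cos z + (b * Complex.sin z + ε z) / (2 * z)

/-- `Δ(z) = cos (z - b/(2z)) + o(n⁻²)` for `|z - π n| ≤ 1`, as `n → ±∞`. -/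
def HasRefinedAsymptotics (Δ : ℂ → ℂ) (b : ℂ) : Prop :=
  ∀ δ > 0, ∀ᶠ n : ℤ in cofinite, ∀ z : ℂ, ‖z - Real.pi * n‖ ≤ 1 →
    ‖Δ z - Complex.cos (z - b / (2 * z))‖ ≤ δ / (n : ℝ) ^ 2

/-- The Cartwright class `𝓔_C(a, a_neg)` of entire functions of types `a` and `a_neg` along the half-axes. The logarithm here takes the value `-∞` at zeros. -/
structure IsCartwright (a a_neg : ℝ) (f : ℂ → ℂ) : Prop where
  entire : Differentiable ℂ f
  exp_type : ∃ A γ : ℝ, ∀ z, ‖f z‖ ≤ A * Real.exp (γ * ‖z‖)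
  log_integrable :
    MeasureTheory.Integrable fun x : ℝ => Real.posLog ‖f x‖ / (1 + x ^ 2)
  type_pos : limsup (fun y : ℝ => ENNReal.log ‖f (Complex.I * y)‖ₑ / (y : EReal)) atTop
    = (a : EReal)
  type_neg : limsup (fun y : ℝ => ENNReal.log ‖f (-(Complex.I * y))‖ₑ / (y : EReal)) atTop
    = (a_neg : EReal)

/-- `f` has finitely many zeros in `U`, and exactly `k` counted with multiplicity. -/
def HasRootCount (f : ℂ → ℂ) (U : Set ℂ) (k : ℕ) : Prop :=
  ∃ S : Finset ℂ, (∀ w, w ∈ S ↔ w ∈ U ∧ f w = 0) ∧ ∑ w ∈ S, analyticOrderAt f w = (k : ℕ∞)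

/-- The family `ζ_α^{n,σ}` (`α = (j, k)`, `j < k`, `j, k ∈ ω`; `n ∈ ℤ ∖ {0}`; a sign `σ`) lists all
zeros of `f`, each as often as its multiplicity. -/
def ListsZeros {N : ℕ} (ω : Finset (Fin N)) (f : ℂ → ℂ)
    (ζ : Fin N × Fin N → Bool → ℤ → ℂ) : Prop :=
  ∀ w : ℂ, analyticOrderAt f w =
    {q : (Fin N × Fin N) × Bool × ℤ |
      q.1 ∈ orderedPairs ω ∧ q.2.2 ≠ 0 ∧ ζ q.1 q.2.1 q.2.2 = w}.encard

/-! The function `ρ_s` is the discriminant of `Φ_s`, hence a resultant of polynomials with entire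
coefficients, so it is entire although the individual branches need not even be continuous.
Multiplying the differences `2z(Δ_j - Δ_k) = (b_j - b_k) sin z + o(e^{|Im z|})` over all pairs and
squaring gives `(2z)^m ρ_s / c_s = sin^m z + o(e^{m|Im z|})` with `m = N_s(N_s - 1)`
(`isLittleO_resonanceFun_sub`). Everything except the type along the negative imaginary axis and the
refinement iii) follows from this relation and from the bound `|sin z| ≥ κ e^{|Im z|}` away from
`πℤ` (`exists_mul_exp_le_norm_sin`).

In the first half only the behaviour as `Im z → +∞` is given, so the type in the lower half-plane
comes from the symmetry `ρ_s(z̄) = conj ρ_s(z)` (`resonanceFun_conj`). For `x ∈ (0, 1)` a zero of `z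
↦ Φ_s(x, z)` yields a multiplier of modulus one, so all zeros are real. This function and its
conjugate reflection then share their zeros. Their quotient is zero-free and tends to `1` on large
circles, so it is `1` by the maximum principle (`conj_apply_conj_of_real_zeros`). Infinitely many
`x` give the symmetry of `Φ_s`, and hence of its discriminant.

The zeros are counted by Rouché's theorem, comparing `(2z)^m ρ_s / c_s` with `sin^m z` on circles
that avoid `πℤ`. For iii), put `z = πn + w/n`. Then `n²(Δ_j - cos πn)` tends to `∓(w - b_j/2π)²/2`,
so differences are asymptotically linear in `w` with zero `(b_j + b_k)/4π`
(`exists_tendsto_resonanceFun`). Rouché's theorem on discs of radius `δ/|n|` then locates the zeros.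
One labelling serves ii) and iii): in each distant disc, take the labelling closest to the predicted
zeros (`exists_map_eq_and_closest`). -/

open scoped ComplexConjugate

/-! ### Zeros in a disc, the argument principle and Rouché's theorem. -/

/-- `Z` is the multiset of zeros of the entire function `f` in the open disc `ball c R`, and `f` has
no zeros on the boundary circle. -/
structure HasZeros (f : ℂ → ℂ) (c : ℂ) (R : ℝ) (Z : Multiset ℂ) : Prop where
  mem_ball : ∀ a ∈ Z, a ∈ Metric.ball c R
  factor : ∃ g : ℂ → ℂ, Differentiable ℂ g ∧ (∀ z ∈ Metric.closedBall c R, g z ≠ 0) ∧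
    ∀ z, f z = (Z.map fun a => z - a).prod * g z

lemma differentiable_prod_sub (Z : Multiset ℂ) :
    Differentiable ℂ fun z => (Z.map fun a => z - a).prod := by
  induction Z using Multiset.induction_on with
  | empty => simp
  | cons a Z ih => simp only [Multiset.map_cons, Multiset.prod_cons]; fun_prop

lemma norm_prod_sub_le {Z : Multiset ℂ} {z : ℂ} {r : ℝ} (h : ∀ a ∈ Z, ‖z - a‖ ≤ r) :
    ‖(Z.map fun a => z - a).prod‖ ≤ r ^ Multiset.card Z := by
  induction Z using Multiset.induction_on with
  | empty => simp
  | cons a Z ih =>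
    simp only [Multiset.map_cons, Multiset.prod_cons, Multiset.card_cons, pow_succ', norm_mul]
    have h1 := h a (by simp)
    exact mul_le_mul h1 (ih fun b hb => h b (by simp [hb])) (norm_nonneg _)
      ((norm_nonneg _).trans h1)

lemma le_norm_prod_sub {Z : Multiset ℂ} {z : ℂ} {r : ℝ} (hr : 0 ≤ r)
    (h : ∀ a ∈ Z, r ≤ ‖z - a‖) :
    r ^ Multiset.card Z ≤ ‖(Z.map fun a => z - a).prod‖ := by
  induction Z using Multiset.induction_on with
  | empty => simp
  | cons a Z ih =>
    simp only [Multiset.map_cons, Multiset.prod_cons, Multiset.card_cons, pow_succ', norm_mul]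
    exact mul_le_mul (h a (by simp)) (ih fun b hb => h b (by simp [hb])) (by positivity)
      (norm_nonneg _)

lemma prod_sub_eq_zero_iff {Z : Multiset ℂ} {z : ℂ} :
    (Z.map fun a => z - a).prod = 0 ↔ z ∈ Z := by
  rw [Multiset.prod_eq_zero_iff]
  simp [sub_eq_zero]

/-- The number of linear factors that can be split off is bounded, so a maximal factorization
exists. Its cofactor cannot vanish in the open disc, since `dslope` would split off one more factor.
-/
lemma exists_hasZeros {f : ℂ → ℂ} (hf : Differentiable ℂ f) {c : ℂ} {R : ℝ} (hR : 0 < R)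
    (hne : ∀ z ∈ Metric.sphere c R, f z ≠ 0) : ∃ Z, HasZeros f c R Z := by
  let S : Set ℕ := {k | ∃ Z : Multiset ℂ, Multiset.card Z = k ∧ (∀ a ∈ Z, a ∈ Metric.ball c R) ∧
    ∃ g : ℂ → ℂ, Differentiable ℂ g ∧ ∀ z, f z = (Z.map fun a => z - a).prod * g z}
  have hp : c + R ∈ Metric.sphere c R := by simp [abs_of_pos hR]
  have hfp := norm_pos_iff.2 (hne _ hp)
  obtain ⟨C, hC⟩ := (isCompact_closedBall c (5 * R)).exists_bound_of_continuousOn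
    hf.continuous.continuousOn
  -- On the circle of radius `5R` each factor is at least `4R`, so the maximum principle bounds the
  -- cofactor by `C / (4R)^k`. At the point `c + R` each factor is at most `2R`, whence `2^k ≤ C /
  -- |f(c + R)|`.
  have hbd : BddAbove S := by
    obtain ⟨K, hK⟩ := pow_unbounded_of_one_lt (C / ‖f (c + R)‖) (by norm_num : (1 : ℝ) < 2)
    refine ⟨K, ?_⟩
    rintro k ⟨Z, rfl, hZ, g, hg, hfg⟩
    by_contra! hlt
    have h1 : ∀ z ∈ frontier (Metric.ball c (5 * R)), ‖g z‖ ≤ C / (4 * R) ^ Multiset.card Z := by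
      intro z hz
      rw [frontier_ball _ (by positivity)] at hz
      rw [le_div_iff₀ (by positivity)]
      have h2 := hC z (Metric.sphere_subset_closedBall hz)
      rw [hfg, norm_mul, mul_comm] at h2
      refine le_trans ?_ h2
      gcongr
      refine le_norm_prod_sub (by positivity) fun a ha => ?_
      have h3 := hZ a ha
      rw [mem_sphere_iff_norm] at hz
      rw [mem_ball_iff_norm] at h3
      have := norm_sub_norm_le (z - c) (a - c)
      rw [sub_sub_sub_cancel_right] at this
      linarith
    have h4 : ‖g (c + R)‖ ≤ C / (4 * R) ^ Multiset.card Z :=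
      Complex.norm_le_of_forall_mem_frontier_norm_le Metric.isBounded_ball hg.diffContOnCl h1
        (subset_closure (by simp [abs_of_pos hR]; linarith))
    have h5 : ‖((Z.map fun a => c + R - a).prod : ℂ)‖ ≤ (2 * R) ^ Multiset.card Z := by
      refine norm_prod_sub_le fun a ha => ?_
      have h3 := hZ a ha
      rw [mem_ball_iff_norm'] at h3
      have := norm_add_le (c - a) R
      rw [Complex.norm_real, Real.norm_eq_abs, abs_of_pos hR] at this
      rw [show c + R - a = c - a + R by ring]
      linarith
    have h6 : ‖f (c + R)‖ * 2 ^ Multiset.card Z ≤ C := by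
      rw [hfg, norm_mul]
      calc _ ≤ (2 * R) ^ Multiset.card Z * (C / (4 * R) ^ Multiset.card Z) *
            2 ^ Multiset.card Z := by gcongr
        _ = C := by
          rw [show (4 * R) = 2 * R * 2 by ring, mul_pow _ (2 : ℝ)]
          field_simp
    have h7 : (2 : ℝ) ^ K ≤ 2 ^ Multiset.card Z := pow_le_pow_right₀ (by norm_num) hlt.le
    rw [div_lt_iff₀ hfp] at hK
    nlinarith
  have hS : S.Nonempty := ⟨0, 0, by simp, by simp, f, hf, by simp⟩
  obtain ⟨Z, hcard, hZ, g, hg, hfg⟩ := Nat.sSup_mem hS hbd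
  refine ⟨Z, hZ, g, hg, fun w hw h0 => ?_, hfg⟩
  rcases (Metric.mem_closedBall.1 hw).lt_or_eq with h | h
  · have : sSup S + 1 ∈ S := by
      refine ⟨w ::ₘ Z, by simp [hcard], ?_, dslope g w, ?_, fun z => ?_⟩
      · intro a ha
        rcases Multiset.mem_cons.1 ha with rfl | ha
        · exact h
        · exact hZ a ha
      · have := (Complex.differentiableOn_dslope (f := g) (c := w) Filter.univ_mem).2
          hg.differentiableOn
        exact differentiableOn_univ.1 this
      · have h2 := sub_smul_dslope g w z
        rw [h0, sub_zero, smul_eq_mul] at h2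
        rw [hfg, ← h2, Multiset.map_cons, Multiset.prod_cons]
        ring
    have := le_csSup hbd this
    omega
  · exact hne w h (by rw [hfg, h0, mul_zero])

namespace HasZeros
variable {f h : ℂ → ℂ} {c : ℂ} {R : ℝ} {Z W : Multiset ℂ}

lemma eq_zero_iff (hf : HasZeros f c R Z) {w : ℂ} (hw : w ∈ Metric.closedBall c R) :
    f w = 0 ↔ w ∈ Z := by
  obtain ⟨g, -, hg0, hfg⟩ := hf.factor
  rw [hfg, mul_eq_zero, or_iff_left (hg0 w hw), prod_sub_eq_zero_iff]

lemma ne_zero_of_mem_sphere (hf : HasZeros f c R Z) {w : ℂ} (hw : w ∈ Metric.sphere c R) :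
    f w ≠ 0 := by
  rw [Ne, hf.eq_zero_iff (Metric.sphere_subset_closedBall hw)]
  intro h
  have := hf.mem_ball w h
  rw [Metric.mem_sphere] at hw
  rw [Metric.mem_ball] at this
  exact absurd hw this.ne

lemma analyticOrderAt_prod_sub (Z : Multiset ℂ) (w : ℂ) :
    analyticOrderAt (fun z => (Z.map fun a => z - a).prod) w = Z.count w := by
  induction Z using Multiset.induction_on with
  | empty =>
    simp only [Multiset.map_zero, Multiset.prod_zero, Multiset.count_zero, Nat.cast_zero]
    rw [analyticOrderAt_eq_zero]
    simp
  | cons a Z ih =>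
    simp only [Multiset.map_cons, Multiset.prod_cons]
    have := analyticOrderAt_mul (𝕜 := ℂ) (f := fun z => z - a)
      (g := fun z => (Z.map fun a => z - a).prod) (z₀ := w) (by fun_prop)
      ((differentiable_prod_sub Z).analyticAt w)
    rw [show (fun z => (z - a) * (Z.map fun a => z - a).prod) =
      (fun z => z - a) * fun z => (Z.map fun a => z - a).prod from rfl, this, ih,
      Multiset.count_cons, add_comm]
    split_ifs with hwa
    · subst hwa
      have : analyticOrderAt (fun z => z - w) w = 1 := analyticOrderAt_id_sub_const_self
      rw [this]; simp
    · have : analyticOrderAt (fun z => z - a) w = 0 := analyticOrderAt_id_sub_const_of_ne hwa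
      rw [this]; simp

lemma analyticOrderAt_eq (hf : HasZeros f c R Z) {w : ℂ} (hw : w ∈ Metric.closedBall c R) :
    analyticOrderAt f w = Z.count w := by
  obtain ⟨g, hg, hg0, hfg⟩ := hf.factor
  rw [show f = (fun z => (Z.map fun a => z - a).prod) * g from funext hfg,
    analyticOrderAt_mul ((differentiable_prod_sub Z).analyticAt w) (hg.analyticAt w),
    analyticOrderAt_prod_sub, analyticOrderAt_eq_zero.2 (Or.inr (hg0 w hw)), add_zero]

/-- The argument principle: each linear factor contributes `(z - a)⁻¹` to the logarithmic
derivative, and the zero-free cofactor contributes nothing, by Cauchy's theorem. -/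
lemma circleIntegral_logDeriv (hR : 0 < R) (hf : HasZeros f c R Z) :
    ∮ z in C(c, R), logDeriv f z = 2 * Real.pi * Complex.I * Multiset.card Z := by
  obtain ⟨g, hg, hg0, hfg⟩ := hf.factor
  have hmem := hf.mem_ball
  obtain rfl : f = fun z => (Z.map fun a => z - a).prod * g z := funext hfg
  clear hf hfg
  have hgc : ContinuousOn (logDeriv g) (Metric.closedBall c R) :=
    ((hg.deriv).continuous.continuousOn).div hg.continuous.continuousOn hg0
  induction Z using Multiset.induction_on with
  | empty =>
    simp only [Multiset.map_zero, Multiset.prod_zero, one_mul, Multiset.card_zero, Nat.cast_zero,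
      mul_zero]
    refine DiffContOnCl.circleIntegral_eq_zero hR.le (DifferentiableOn.diffContOnCl ?_)
    rw [closure_ball c hR.ne']
    exact hg.deriv.differentiableOn.div hg.differentiableOn hg0
  | cons a Z ih =>
    have ha := hmem a (by simp)
    have hZ : ∀ b ∈ Z, b ∈ Metric.ball c R := fun b hb => hmem b (by simp [hb])
    have hns : ∀ b ∈ Metric.ball c R, ∀ z ∈ Metric.sphere c R, z - b ≠ 0 := by
      intro b hb z hz h0
      rw [sub_eq_zero] at h0
      subst h0
      exact absurd (Metric.mem_sphere.1 hz) (Metric.mem_ball.1 hb).ne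
    have hd : Differentiable ℂ fun z => (Z.map fun a => z - a).prod * g z :=
      (differentiable_prod_sub Z).mul hg
    have hne : ∀ z ∈ Metric.sphere c R, (Z.map fun a => z - a).prod * g z ≠ 0 := by
      intro z hz
      refine mul_ne_zero ?_ (hg0 z (Metric.sphere_subset_closedBall hz))
      rw [Ne, prod_sub_eq_zero_iff]
      exact fun h => hns z (hZ z h) z hz (sub_self z)
    have hEq : Set.EqOn (logDeriv fun z => ((a ::ₘ Z).map fun a => z - a).prod * g z)
        (fun z => (z - a)⁻¹ + logDeriv (fun z => (Z.map fun a => z - a).prod * g z) z)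
        (Metric.sphere c R) := by
      intro z hz
      have h1 := logDeriv_mul (f := fun z => z - a)
        (g := fun z => (Z.map fun a => z - a).prod * g z) z (hns a ha z hz) (hne z hz)
        (by fun_prop) hd.differentiableAt
      have h2 : logDeriv (fun z => z - a) z = (z - a)⁻¹ := by
        rw [logDeriv_apply]; simp
      rw [h2] at h1
      simp only [Multiset.map_cons, Multiset.prod_cons, mul_assoc]
      exact h1
    rw [circleIntegral.integral_congr hR.le hEq, circleIntegral.integral_add, ih hZ,
      circleIntegral.integral_sub_inv_of_mem_ball ha, Multiset.card_cons]
    · push_cast; ring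
    · refine ContinuousOn.circleIntegrable hR.le ?_
      exact ContinuousOn.inv₀ (by fun_prop) (hns a ha)
    · refine ContinuousOn.circleIntegrable hR.le ?_
      exact hd.deriv.continuous.continuousOn.div hd.continuous.continuousOn hne

lemma differentiable (hf : HasZeros f c R Z) : Differentiable ℂ f := by
  obtain ⟨g, hg, hg0, hfg⟩ := hf.factor
  rw [show f = (fun z => (Z.map fun a => z - a).prod) * g from funext hfg]
  exact (differentiable_prod_sub Z).mul hg

/-- **Rouché's theorem** on a disc. -/
theorem card_eq_of_norm_sub_lt (hR : 0 < R) (hf : HasZeros f c R Z) (hh : HasZeros h c R W)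
    (hlt : ∀ z ∈ Metric.sphere c R, ‖f z - h z‖ < ‖h z‖) :
    Multiset.card Z = Multiset.card W := by
  have hfd := hf.differentiable
  have hhd := hh.differentiable
  have hint : ∀ {k : ℂ → ℂ} {V : Multiset ℂ}, HasZeros k c R V →
      CircleIntegrable (logDeriv k) c R := fun hk =>
    ContinuousOn.circleIntegrable hR.le <|
      hk.differentiable.deriv.continuous.continuousOn.div hk.differentiable.continuous.continuousOn
        fun z hz => hk.ne_zero_of_mem_sphere hz
  -- On the circle `f / h` stays within distance `1` of `1`, so the principal logarithm of `f / h`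
  -- is a primitive there.
  have h1 : ∮ z in C(c, R), (logDeriv f z - logDeriv h z) = 0 := by
    refine circleIntegral.integral_eq_zero_of_hasDerivWithinAt
      (f := fun z => Complex.log (f z / h z)) hR.le fun z hz => ?_
    have hhz := hh.ne_zero_of_mem_sphere hz
    have hfz := hf.ne_zero_of_mem_sphere hz
    have hs : f z / h z ∈ Complex.slitPlane := by
      suffices ‖f z / h z - 1‖ < 1 by
        simpa using Complex.mem_slitPlane_of_norm_lt_one this
      rw [div_sub_one hhz, norm_div, div_lt_one (norm_pos_iff.2 hhz)]
      exact hlt z hz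
    have h2 := ((hfd z).hasDerivAt.div (hhd z).hasDerivAt hhz).clog hs
    refine (h2.congr_deriv ?_).hasDerivWithinAt
    rw [logDeriv_apply, logDeriv_apply, Pi.div_apply]
    field_simp
  rw [circleIntegral.integral_sub (hint hf) (hint hh), circleIntegral_logDeriv hR hf,
    circleIntegral_logDeriv hR hh, sub_eq_zero] at h1
  have h3 : (2 * Real.pi * Complex.I : ℂ) ≠ 0 := Complex.two_pi_I_ne_zero
  exact_mod_cast mul_left_cancel₀ h3 h1

lemma mul (hf : HasZeros f c R Z) (hh : HasZeros h c R W) :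
    HasZeros (fun z => f z * h z) c R (Z + W) := by
  obtain ⟨g, hg, hg0, hfg⟩ := hf.factor
  obtain ⟨k, hk, hk0, hhk⟩ := hh.factor
  refine ⟨fun a ha => ?_, fun z => g z * k z, hg.mul hk,
    fun z hz => mul_ne_zero (hg0 z hz) (hk0 z hz), fun z => ?_⟩
  · rcases Multiset.mem_add.1 ha with ha | ha
    exacts [hf.mem_ball a ha, hh.mem_ball a ha]
  · rw [hfg, hhk, Multiset.map_add, Multiset.prod_add]; ring

lemma const {k : ℂ} (hk : k ≠ 0) : HasZeros (fun _ => k) c R 0 :=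
  ⟨by simp, fun _ => k, by fun_prop, fun _ _ => hk, by simp⟩

lemma pow (hf : HasZeros f c R Z) (n : ℕ) : HasZeros (fun z => f z ^ n) c R (n • Z) := by
  induction n with
  | zero => simpa using const one_ne_zero
  | succ n ih =>
    simp only [pow_succ, succ_nsmul]
    exact ih.mul hf

lemma sub_const {a : ℂ} (ha : a ∈ Metric.ball c R) : HasZeros (fun z => z - a) c R {a} :=
  ⟨by simpa using ha, fun _ => 1, by fun_prop, by simp, by simp⟩

lemma hasRootCount (hf : HasZeros f c R Z) :
    HasRootCount f (Metric.ball c R) (Multiset.card Z) := by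
  refine ⟨Z.toFinset, fun w => ?_, ?_⟩
  · rw [Multiset.mem_toFinset]
    refine ⟨fun h => ⟨hf.mem_ball w h, ?_⟩, fun h => ?_⟩
    · exact (hf.eq_zero_iff (Metric.ball_subset_closedBall (hf.mem_ball w h))).2 h
    · exact (hf.eq_zero_iff (Metric.ball_subset_closedBall h.1)).1 h.2
  · rw [← Multiset.toFinset_sum_count_eq, Nat.cast_sum]
    refine Finset.sum_congr rfl fun w hw => ?_
    exact hf.analyticOrderAt_eq
      (Metric.ball_subset_closedBall (hf.mem_ball w (Multiset.mem_toFinset.1 hw)))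

/-- If the zeros of `f` in a disc are exactly the elements of `S`, all of them of order `m`, then
there are `m * #S` of them. -/
lemma card_eq_mul {m : ℕ} {S : Finset ℂ} (hf : HasZeros f c R Z)
    (hS : ∀ w, w ∈ S ↔ w ∈ Metric.ball c R ∧ f w = 0) (hm : ∀ w ∈ S, analyticOrderAt f w = m) :
    Multiset.card Z = S.card * m := by
  have hZS : Z.toFinset = S := by
    ext w
    rw [Multiset.mem_toFinset, hS]
    refine ⟨fun h => ⟨hf.mem_ball w h, ?_⟩, fun h => ?_⟩
    · exact (hf.eq_zero_iff (Metric.ball_subset_closedBall (hf.mem_ball w h))).2 h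
    · exact (hf.eq_zero_iff (Metric.ball_subset_closedBall h.1)).1 h.2
  rw [← Multiset.toFinset_sum_count_eq, hZS, Finset.sum_const_nat fun w hw => ?_]
  have h1 := hf.analyticOrderAt_eq (Metric.ball_subset_closedBall ((hS w).1 hw).1)
  rw [hm w hw] at h1
  exact_mod_cast h1.symm

end HasZeros

/-! ### Size and zeros of the sine. -/

lemma norm_sin_sq (z : ℂ) : ‖Complex.sin z‖ ^ 2 = Real.sin z.re ^ 2 + Real.sinh z.im ^ 2 := by
  rw [← Complex.normSq_eq_norm_sq, Complex.sin_eq, ← Complex.ofReal_sin, ← Complex.ofReal_cosh,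
    ← Complex.ofReal_cos, ← Complex.ofReal_sinh, ← Complex.ofReal_mul, ← Complex.ofReal_mul,
    Complex.normSq_add_mul_I, mul_pow, mul_pow, Real.cosh_sq, Real.cos_sq']
  ring

lemma norm_exp_mul_I_le (z : ℂ) : ‖Complex.exp (z * Complex.I)‖ ≤ Real.exp |z.im| := by
  rw [Complex.norm_exp]
  simpa using neg_le_abs z.im

lemma norm_sin_le_exp (z : ℂ) : ‖Complex.sin z‖ ≤ Real.exp |z.im| := by
  have h1 := norm_exp_mul_I_le z
  have h2 := norm_exp_mul_I_le (-z)
  rw [Complex.neg_im, abs_neg] at h2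
  rw [Complex.sin, norm_div, norm_mul, Complex.norm_I, Complex.norm_ofNat]
  have := norm_sub_le (Complex.exp (-z * Complex.I)) (Complex.exp (z * Complex.I))
  linarith

lemma norm_cos_le_exp (z : ℂ) : ‖Complex.cos z‖ ≤ Real.exp |z.im| := by
  have h1 := norm_exp_mul_I_le z
  have h2 := norm_exp_mul_I_le (-z)
  rw [Complex.neg_im, abs_neg] at h2
  rw [Complex.cos, norm_div, Complex.norm_ofNat]
  have := norm_add_le (Complex.exp (z * Complex.I)) (Complex.exp (-z * Complex.I))
  linarith

/-- Away from its zeros, the sine is comparable to `exp |Im z|`. -/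
lemma exists_mul_exp_le_norm_sin {δ : ℝ} (hδ : 0 < δ) : ∃ κ > 0, ∀ z : ℂ,
    (∀ n : ℤ, δ ≤ ‖z - Real.pi * n‖) → κ * Real.exp |z.im| ≤ ‖Complex.sin z‖ := by
  have hπ := Real.pi_pos
  have he : Real.exp (-δ) < 1 := by rw [Real.exp_lt_one_iff]; linarith
  refine ⟨min ((1 - Real.exp (-δ)) / 2) (δ / Real.pi * Real.exp (-(δ / 2))), ?_, fun z hz => ?_⟩
  · have : 0 < 1 - Real.exp (-δ) := by linarith
    positivity
  have hsq := norm_sin_sq z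
  -- Either the imaginary part is at least `δ/2` and `sinh` gives the bound, or the real part is at
  -- distance at least `δ/2` from `πℤ` and Jordan's inequality does.
  rcases le_or_gt (δ / 2) |z.im| with h | h
  · refine le_trans (mul_le_mul_of_nonneg_right (min_le_left _ _) (by positivity)) ?_
    have h1 : Real.sinh |z.im| ≤ ‖Complex.sin z‖ := by
      refine le_of_sq_le_sq ?_ (norm_nonneg _)
      have h0 : Real.sinh |z.im| ^ 2 = Real.sinh z.im ^ 2 := by
        rcases abs_choice z.im with h | h <;> rw [h]
        rw [Real.sinh_neg, neg_sq]
      rw [hsq, h0]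
      nlinarith [sq_nonneg (Real.sin z.re)]
    refine le_trans ?_ h1
    rw [Real.sinh_eq]
    have h2 : Real.exp (-|z.im|) ≤ Real.exp (-δ) * Real.exp |z.im| := by
      rw [← Real.exp_add]
      exact Real.exp_le_exp.2 (by linarith)
    linarith
  · refine le_trans (mul_le_mul_of_nonneg_right (min_le_right _ _) (by positivity)) ?_
    set n : ℤ := round (z.re / Real.pi) with hn
    have h1 : |z.re - Real.pi * n| ≤ Real.pi / 2 := by
      have := abs_sub_round (z.re / Real.pi)
      rw [← hn, div_sub' hπ.ne', abs_div, abs_of_pos hπ, div_le_iff₀ hπ] at this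
      linarith
    have h2 : δ / 2 ≤ |z.re - Real.pi * n| := by
      have h3 := hz n
      have h4 := Complex.norm_le_abs_re_add_abs_im (z - Real.pi * n)
      have h5 : (z - Real.pi * n).re = z.re - Real.pi * n := by simp
      have h6 : (z - Real.pi * n).im = z.im := by simp
      rw [h5, h6] at h4
      linarith
    have h3 : |Real.sin (z.re - Real.pi * n)| = |Real.sin z.re| := by
      rw [mul_comm, Real.sin_sub_int_mul_pi, abs_mul, abs_zpow]
      simp
    have h4 := Real.mul_abs_le_abs_sin h1
    rw [h3] at h4
    have h5 : |Real.sin z.re| ≤ ‖Complex.sin z‖ := by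
      refine le_of_sq_le_sq ?_ (norm_nonneg _)
      rw [hsq, sq_abs]
      nlinarith [sq_nonneg (Real.sinh z.im)]
    have h6 : Real.exp (-(δ / 2)) * Real.exp |z.im| ≤ 1 := by
      rw [← Real.exp_add, Real.exp_le_one_iff]
      linarith
    calc δ / Real.pi * Real.exp (-(δ / 2)) * Real.exp |z.im|
        = δ / Real.pi * (Real.exp (-(δ / 2)) * Real.exp |z.im|) := by ring
      _ ≤ δ / Real.pi * 1 := by gcongr
      _ = 2 / Real.pi * (δ / 2) := by ring
      _ ≤ 2 / Real.pi * |z.re - Real.pi * n| := by gcongr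
      _ ≤ _ := h4.trans h5

lemma norm_pi_mul_int_sub (n k : ℤ) :
    ‖(Real.pi * n - Real.pi * k : ℂ)‖ = Real.pi * |(n - k : ℤ)| := by
  rw [← mul_sub, norm_mul, Complex.norm_real, Real.norm_of_nonneg Real.pi_pos.le,
    ← Int.cast_sub, Complex.norm_intCast]
  push_cast; rfl

lemma pi_le_norm_pi_mul_int_sub {n k : ℤ} (h : n ≠ k) :
    Real.pi ≤ ‖(Real.pi * n - Real.pi * k : ℂ)‖ := by
  rw [norm_pi_mul_int_sub]
  have : (1 : ℝ) ≤ |(n - k : ℤ)| := by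
    exact_mod_cast Int.one_le_abs (sub_ne_zero.2 h)
  nlinarith [Real.pi_pos]

lemma norm_pi_mul_int (n : ℤ) : ‖(Real.pi * n : ℂ)‖ = Real.pi * |(n : ℤ)| := by
  simpa using norm_pi_mul_int_sub n 0

/-- On the circle `|z| = π (n + 1/2)` the distance to `πℤ` is at least `π / 2`. -/
lemma le_norm_sub_of_norm_eq {z : ℂ} {n : ℕ} (hz : ‖z‖ = Real.pi * (n + 1 / 2)) (k : ℤ) :
    Real.pi / 2 ≤ ‖z - Real.pi * k‖ := by
  have h1 := abs_norm_sub_norm_le z (Real.pi * k)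
  rw [hz, norm_pi_mul_int] at h1
  refine le_trans ?_ h1
  have hπ := Real.pi_pos
  rcases le_or_gt |k| n with h | h
  · have : ((|k| : ℤ) : ℝ) ≤ n := by exact_mod_cast h
    refine le_trans ?_ (le_abs_self _)
    nlinarith
  · have : (n : ℝ) + 1 ≤ ((|k| : ℤ) : ℝ) := by exact_mod_cast h
    refine le_trans ?_ (neg_le_abs _)
    nlinarith

/-- On the circle `|z - π n| = π / 2` the distance to `πℤ` is at least `π / 2`. -/
lemma le_norm_sub_of_mem_sphere {z : ℂ} {n : ℤ} (hz : ‖z - Real.pi * n‖ = Real.pi / 2) (k : ℤ) :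
    Real.pi / 2 ≤ ‖z - Real.pi * k‖ := by
  rcases eq_or_ne n k with rfl | h
  · exact hz.ge
  · have h1 := pi_le_norm_pi_mul_int_sub h
    have h2 := norm_sub_le (z - Real.pi * k) (z - Real.pi * n)
    rw [sub_sub_sub_cancel_left] at h2
    rw [hz] at h2
    linarith

lemma analyticOrderAt_sin_of_eq_zero {w : ℂ} (hw : Complex.sin w = 0) :
    analyticOrderAt Complex.sin w = 1 := by
  refine AnalyticAt.analyticOrderAt_eq_one_of_zero_deriv_ne_zero
    (Complex.differentiable_sin.analyticAt w) hw ?_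
  rw [Complex.deriv_sin]
  intro h
  have := Complex.sin_sq_add_cos_sq w
  simp [hw, h] at this

lemma sin_ne_zero_of_le_norm_sub {δ : ℝ} (hδ : 0 < δ) {z : ℂ}
    (hz : ∀ n : ℤ, δ ≤ ‖z - Real.pi * n‖) : Complex.sin z ≠ 0 := by
  obtain ⟨κ, hκ, h⟩ := exists_mul_exp_le_norm_sin hδ
  rw [← norm_pos_iff]
  exact lt_of_lt_of_le (by positivity) (h z hz)

lemma sin_eq_zero_iff_exists_int {w : ℂ} : Complex.sin w = 0 ↔ ∃ k : ℤ, w = Real.pi * k := by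
  rw [Complex.sin_eq_zero_iff]
  simp only [mul_comm]

/-- The sine has `2 n + 1` zeros in the disc `|z| < π (n + 1/2)`. -/
lemma exists_hasZeros_sin_zero (n : ℕ) :
    ∃ Z, HasZeros Complex.sin 0 (Real.pi * (n + 1 / 2)) Z ∧ Multiset.card Z = 2 * n + 1 := by
  have hπ := Real.pi_pos
  obtain ⟨Z, hZ⟩ := exists_hasZeros Complex.differentiable_sin (c := 0)
    (R := Real.pi * (n + 1 / 2)) (by positivity) fun z hz => by
      rw [mem_sphere_zero_iff_norm] at hz
      exact sin_ne_zero_of_le_norm_sub (by positivity) (le_norm_sub_of_norm_eq hz)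
  refine ⟨Z, hZ, ?_⟩
  have hinj : Function.Injective fun k : ℤ => (Real.pi * k : ℂ) := by
    intro a b hab
    by_contra h
    have := pi_le_norm_pi_mul_int_sub h
    simp only at hab
    rw [hab, sub_self, norm_zero] at this
    linarith
  have := hZ.card_eq_mul (m := 1) (S := (Finset.Icc (-n : ℤ) n).image fun k : ℤ => (Real.pi * k : ℂ))
    (fun w => ?_) fun w hw => ?_
  · rw [this, Finset.card_image_of_injective _ hinj, Int.card_Icc]
    omega
  · have key : ∀ k : ℤ, ‖(Real.pi * k : ℂ)‖ < Real.pi * (n + 1 / 2) ↔ k ∈ Finset.Icc (-n : ℤ) n := by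
      intro k
      rw [norm_pi_mul_int, mul_lt_mul_iff_right₀ hπ, Finset.mem_Icc, ← abs_le]
      constructor
      · intro h
        by_contra! h'
        have : (n : ℝ) + 1 ≤ ((|k| : ℤ) : ℝ) := by exact_mod_cast h'
        linarith
      · intro h
        have : ((|k| : ℤ) : ℝ) ≤ n := by exact_mod_cast h
        linarith
    rw [mem_ball_zero_iff, Finset.mem_image, sin_eq_zero_iff_exists_int]
    constructor
    · rintro ⟨k, hk, rfl⟩
      exact ⟨(key k).2 hk, k, rfl⟩
    · rintro ⟨h, k, rfl⟩
      exact ⟨k, (key k).1 h, rfl⟩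
  · obtain ⟨k, -, rfl⟩ := Finset.mem_image.1 hw
    exact analyticOrderAt_sin_of_eq_zero (sin_eq_zero_iff_exists_int.2 ⟨k, rfl⟩)

/-- The sine has one zero in the disc `|z - π n| < π / 2`. -/
lemma exists_hasZeros_sin_pi_mul (n : ℤ) :
    ∃ Z, HasZeros Complex.sin (Real.pi * n) (Real.pi / 2) Z ∧ Multiset.card Z = 1 := by
  have hπ := Real.pi_pos
  obtain ⟨Z, hZ⟩ := exists_hasZeros Complex.differentiable_sin (c := Real.pi * n)
    (R := Real.pi / 2) (by positivity) fun z hz => by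
      rw [mem_sphere_iff_norm] at hz
      exact sin_ne_zero_of_le_norm_sub (by positivity) (le_norm_sub_of_mem_sphere hz)
  refine ⟨Z, hZ, ?_⟩
  have := hZ.card_eq_mul (m := 1) (S := {(Real.pi * n : ℂ)}) (fun w => ?_) fun w hw => ?_
  · simpa using this
  · rw [mem_ball_iff_norm, Finset.mem_singleton, sin_eq_zero_iff_exists_int]
    constructor
    · rintro rfl
      exact ⟨by simpa using hπ, n, rfl⟩
    · rintro ⟨h, k, rfl⟩
      by_contra hne
      have := pi_le_norm_pi_mul_int_sub (n := k) (k := n) (by rintro rfl; exact hne rfl)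
      linarith
  · rw [Finset.mem_singleton.1 hw]
    exact analyticOrderAt_sin_of_eq_zero (sin_eq_zero_iff_exists_int.2 ⟨n, rfl⟩)

/-! ### The discriminant as a resultant, and entireness of `ρ_s`. -/

lemma prod_orderedPairs_neg_sq {N : ℕ} (ω : Finset (Fin N)) (x : Fin N → ℂ) :
    ∏ j ∈ ω, ∏ k ∈ ω.erase j, (x j - x k) =
      (-1) ^ (orderedPairs ω).card * ∏ p ∈ orderedPairs ω, (x p.1 - x p.2) ^ 2 := by
  have h1 : ∏ j ∈ ω, ∏ k ∈ ω.erase j, (x j - x k) =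
      ∏ p ∈ (ω ×ˢ ω).filter fun p => p.1 ≠ p.2, (x p.1 - x p.2) := by
    rw [Finset.prod_filter, Finset.prod_product]
    refine Finset.prod_congr rfl fun j _ => ?_
    rw [← Finset.prod_filter]
    refine Finset.prod_congr ?_ fun _ _ => rfl
    ext k; simp [ne_comm, and_comm]
  have h2 : (ω ×ˢ ω).filter (fun p => p.1 ≠ p.2) =
      orderedPairs ω ∪ (ω ×ˢ ω).filter fun p => p.2 < p.1 := by
    ext p; simp only [orderedPairs, Finset.mem_union, Finset.mem_filter, ne_iff_lt_or_gt]; tauto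
  have h3 : Disjoint (orderedPairs ω) ((ω ×ˢ ω).filter fun p => p.2 < p.1) := by
    rw [orderedPairs, Finset.disjoint_filter]
    exact fun p _ h => h.not_gt
  have h4 : ∏ p ∈ (ω ×ˢ ω).filter (fun p => p.2 < p.1), (x p.1 - x p.2) =
      ∏ p ∈ orderedPairs ω, (x p.2 - x p.1) := by
    refine Finset.prod_nbij' Prod.swap Prod.swap ?_ ?_ (by simp) (by simp) (by simp)
    all_goals
      intro p
      simp only [orderedPairs, Finset.mem_filter, Finset.mem_product, Prod.fst_swap, Prod.snd_swap]
      tauto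
  rw [h1, h2, Finset.prod_union h3, h4, ← Finset.prod_mul_distrib, ← Finset.prod_const,
    ← Finset.prod_mul_distrib]
  exact Finset.prod_congr rfl fun p _ => by ring

lemma card_orderedPairs {N : ℕ} (ω : Finset (Fin N)) :
    2 * (orderedPairs ω).card = ω.card * (ω.card - 1) := by
  have h2 : ω.offDiag = orderedPairs ω ∪ (ω ×ˢ ω).filter fun p => p.2 < p.1 := by
    ext p
    simp only [orderedPairs, Finset.mem_union, Finset.mem_filter, Finset.mem_offDiag,
      ne_iff_lt_or_gt, Finset.mem_product]
    tauto
  have h3 : Disjoint (orderedPairs ω) ((ω ×ˢ ω).filter fun p => p.2 < p.1) := by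
    rw [orderedPairs, Finset.disjoint_filter]
    exact fun p _ h => h.not_gt
  have h4 : ((ω ×ˢ ω).filter fun p => p.2 < p.1).card = (orderedPairs ω).card := by
    refine Finset.card_nbij' Prod.swap Prod.swap ?_ ?_ (by simp [Set.LeftInvOn]) (by simp [Set.LeftInvOn])
    all_goals
      intro p
      simp only [orderedPairs, Finset.coe_filter, Set.mem_ofPred_eq, Finset.mem_product, Prod.fst_swap, Prod.snd_swap]
      tauto
  rw [Nat.mul_sub, mul_one, ← Finset.offDiag_card, h2, Finset.card_union_of_disjoint h3, h4, two_mul]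

/-- This expresses a symmetric function of the roots through the coefficients. The formal degree
given to the derivative may exceed its true degree: that only introduces a power of the leading
coefficient, which is `1`. -/
lemma prod_orderedPairs_sq_eq_resultant {N : ℕ} (ω : Finset (Fin N)) (x : Fin N → ℂ) :
    ∏ p ∈ orderedPairs ω, (x p.1 - x p.2) ^ 2 = (-1) ^ (orderedPairs ω).card *
      (∏ j ∈ ω, (X - C (x j))).resultant (derivative (∏ j ∈ ω, (X - C (x j)))) ω.card ω.card := by
  set P : ℂ[X] := ∏ j ∈ ω, (X - C (x j)) with hP
  have hdeg : P.natDegree = ω.card := by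
    rw [hP, natDegree_prod_of_monic _ _ fun j _ => monic_X_sub_C _]
    simp
  have hmonic : P.Monic := monic_prod_of_monic _ _ fun j _ => monic_X_sub_C _
  have hroots : P.roots = ω.val.map x := by
    have := roots_multiset_prod_X_sub_C (ω.val.map x)
    rwa [Multiset.map_map] at this
  have h1 := resultant_eq_prod_eval P (derivative P) ω.card
    ((natDegree_derivative_le P).trans (by omega)) (IsAlgClosed.splits P)
  rw [hdeg, hmonic.leadingCoeff, one_pow, one_mul, hroots, Multiset.map_map] at h1
  have h2 : (Multiset.map ((fun y => eval y (derivative P)) ∘ x) ω.val).prod =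
      ∏ j ∈ ω, ∏ k ∈ ω.erase j, (x j - x k) := by
    refine Finset.prod_congr rfl fun j hj => ?_
    rw [Function.comp_apply, hP, derivative_prod_finset, eval_finsetSum, Finset.sum_eq_single j]
    · simp [eval_prod]
    · intro k _ hkj
      rw [eval_mul, eval_prod, Finset.prod_eq_zero (i := j), zero_mul]
      · exact Finset.mem_erase.2 ⟨hkj.symm, hj⟩
      · simp
    · exact fun h => absurd hj h
  rw [h1, h2, prod_orderedPairs_neg_sq, ← mul_assoc, ← pow_add, Even.neg_one_pow ⟨_, rfl⟩, one_mul]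

section Decomposition
variable {N N₀ : ℕ} {M : ℂ → Matrix (Fin N) (Fin N) ℂ} {τ : Fin N → ℂ → ℂ}
  {ω : Fin N₀ → Finset (Fin N)} {Φ : Fin N₀ → Polynomial entireFunctions}

lemma resonanceFun_eq_resultant (hdec : IsLyapunovDecomposition M τ ω Φ) (s : Fin N₀) (z : ℂ) :
    resonanceFun τ (ω s) z = (-1) ^ (orderedPairs (ω s)).card *
      ((Φ s).map (entireFunctions.evalAt z)).resultant
        (derivative ((Φ s).map (entireFunctions.evalAt z))) (ω s).card (ω s).card := by
  rw [hdec.branches s z, ← prod_orderedPairs_sq_eq_resultant, resonanceFun]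

/-- The resultant with fixed formal degrees commutes with ring homomorphisms, so it can be formed in
the ring of entire functions before evaluating at `z`. -/
lemma differentiable_resonanceFun (hdec : IsLyapunovDecomposition M τ ω Φ) (s : Fin N₀) :
    Differentiable ℂ (resonanceFun τ (ω s)) := by
  have h : resonanceFun τ (ω s) = fun z => (-1) ^ (orderedPairs (ω s)).card *
      ((Φ s).resultant (derivative (Φ s)) (ω s).card (ω s).card : entireFunctions).1 z := by
    ext z
    rw [resonanceFun_eq_resultant hdec, derivative_map, resultant_map_map]
    rfl
  rw [h]
  exact (Subtype.property _ : Differentiable ℂ _).const_mul _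

/-! ### Symmetry of `Φ_s` and `ρ_s` under conjugation. -/

lemma differentiable_eval_map (P : Polynomial entireFunctions) (μ : ℂ) :
    Differentiable ℂ fun z => (P.map (entireFunctions.evalAt z)).eval μ := by
  have h : (fun z => (P.map (entireFunctions.evalAt z)).eval μ) =
      fun z => ∑ i ∈ Finset.range (P.natDegree + 1), (P.coeff i).1 z * μ ^ i := by
    ext z
    rw [eval_map, eval₂_eq_sum_range]
    rfl
  rw [h]
  have h2 : ∀ i, Differentiable ℂ (P.coeff i).1 := fun i => (P.coeff i).2
  fun_prop

/-- A root of modulus one is forced by a real value of `(τ + τ⁻¹)/2` in `(0, 1)`. -/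
lemma norm_eq_one_of_half_add_inv {t : ℂ} {x : ℝ} (h0 : 0 < x) (h1 : x < 1)
    (h : (t + t⁻¹) / 2 = x) : ‖t‖ = 1 := by
  have ht : t ≠ 0 := by
    rintro rfl
    have : (x : ℂ) = 0 := by simpa using h.symm
    exact h0.ne' (by exact_mod_cast this)
  -- The equation is `t² - 2xt + 1 = 0`, with roots `x ± i √(1 - x²)` on the unit circle.
  have h2 : (t - x) ^ 2 = (Real.sqrt (1 - x ^ 2) * Complex.I) ^ 2 := by
    rw [mul_pow, Complex.I_sq, ← Complex.ofReal_pow, Real.sq_sqrt (by nlinarith)]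
    have : t * t⁻¹ = 1 := mul_inv_cancel₀ ht
    push_cast
    linear_combination 2 * t * h - this
  have h3 : ∀ y : ℝ, y ^ 2 = 1 - x ^ 2 → t = x + y * Complex.I → ‖t‖ = 1 := by
    intro y hy hty
    rw [← sq_eq_sq₀ (norm_nonneg _) zero_le_one, ← Complex.normSq_eq_norm_sq, hty,
      Complex.normSq_add_mul_I]
    linarith
  have h4 := Real.sq_sqrt (show 0 ≤ 1 - x ^ 2 by nlinarith)
  rcases sq_eq_sq_iff_eq_or_eq_neg.1 h2 with h | h
  · exact h3 _ h4 (by linear_combination h)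
  · exact h3 (-Real.sqrt (1 - x ^ 2)) (by linarith) (by push_cast; linear_combination h)

lemma isRoot_charpoly (hdec : IsLyapunovDecomposition M τ ω Φ) (j : Fin N) (z : ℂ) :
    (M z).charpoly.IsRoot (τ j z) := by
  rw [hdec.multipliers, IsRoot, eval_prod]
  exact Finset.prod_eq_zero (Finset.mem_univ j) (by simp)

end Decomposition

/-- An entire function with real zeros only, which is asymptotically real on large circles, is
real on the real line. -/
lemma conj_apply_conj_of_real_zeros {F : ℂ → ℂ} (hF : Differentiable ℂ F)
    (hreal : ∀ z, F z = 0 → z.im = 0) {R : ℕ → ℝ} (hR : Tendsto R atTop atTop)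
    (hlim : ∀ ε > 0, ∀ᶠ n in atTop, ∀ z ∈ Metric.sphere (0 : ℂ) (R n),
      F z ≠ 0 ∧ ‖conj (F (conj z)) / F z - 1‖ ≤ ε) (z : ℂ) : conj (F (conj z)) = F z := by
  have key : ∀ ε > 0, ‖conj (F (conj z)) - F z‖ ≤ ε * ‖F z‖ := by
    intro ε hε
    obtain ⟨n, hn, hzn, hpos⟩ :=
      ((hlim ε hε).and ((hR.eventually_gt_atTop ‖z‖).and (hR.eventually_gt_atTop 0))).exists
    obtain ⟨Z, hZ⟩ := exists_hasZeros hF hpos fun w hw => (hn w hw).1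
    obtain ⟨g, hg, hg0, hFg⟩ := hZ.factor
    -- The zeros are real, so `F` and its reflection have the same polynomial factor, and the
    -- quotient of the two is a quotient of holomorphic functions with zero-free denominator.
    have hZconj : ∀ w, conj ((Z.map fun a => conj w - a).prod) = (Z.map fun a => w - a).prod := by
      intro w
      rw [map_multiset_prod, Multiset.map_map]
      congr 1
      refine Multiset.map_congr rfl fun a ha => ?_
      have : a.im = 0 :=
        hreal a ((hZ.eq_zero_iff (Metric.ball_subset_closedBall (hZ.mem_ball a ha))).2 ha)
      simp [Complex.conj_eq_iff_im.2 this]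
    have hFc : ∀ w, conj (F (conj w)) = (Z.map fun a => w - a).prod * conj (g (conj w)) := by
      intro w
      rw [hFg, map_mul, hZconj]
    have hgc : Differentiable ℂ fun w => conj (g (conj w)) := fun w =>
      differentiableAt_conj_conj_iff.2 (hg _)
    have hdiff : DifferentiableOn ℂ (fun w => conj (g (conj w)) / g w - 1)
        (Metric.closedBall 0 (R n)) :=
      (hgc.differentiableOn.div hg.differentiableOn hg0).sub_const 1
    have hzb : z ∈ Metric.closedBall (0 : ℂ) (R n) := by simpa using hzn.le
    have h1 : ‖conj (g (conj z)) / g z - 1‖ ≤ ε := by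
      refine Complex.norm_le_of_forall_mem_frontier_norm_le
        (f := fun w => conj (g (conj w)) / g w - 1) (Metric.isBounded_ball (x := 0) (r := R n))
        (DifferentiableOn.diffContOnCl ?_) (fun w hw => ?_) ?_
      · rwa [closure_ball _ hpos.ne']
      · rw [frontier_ball _ hpos.ne'] at hw
        obtain ⟨h1, h2⟩ := hn w hw
        rw [hFc] at h2
        rw [hFg] at h1 h2
        rwa [mul_div_mul_left _ _ (left_ne_zero_of_mul h1)] at h2
      · rwa [closure_ball _ hpos.ne']
    rw [hFc, hFg, ← mul_sub, norm_mul, norm_mul]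
    have h2 := hg0 z hzb
    rw [div_sub_one h2, norm_div, div_le_iff₀ (norm_pos_iff.2 h2)] at h1
    calc _ ≤ ‖(Z.map fun a => z - a).prod‖ * (ε * ‖g z‖) := by gcongr
      _ = _ := by ring
  have h0 : ‖conj (F (conj z)) - F z‖ ≤ 0 := by
    refine le_of_forall_pos_le_add fun ε hε => ?_
    refine (key (ε / (‖F z‖ + 1)) (by positivity)).trans ?_
    rw [zero_add, div_mul_eq_mul_div, div_le_iff₀ (by positivity)]
    nlinarith
  exact sub_eq_zero.1 (norm_le_zero_iff.1 h0)

/-- A lower bound for `cos z - x`, `x ∈ (0, 1)`, on the circles `|z| = π (2 n + 1)`. -/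
lemma exists_mul_exp_le_norm_cos_sub : ∃ κ > 0, ∀ (x : ℝ), 0 < x → x < 1 → ∀ (n : ℕ) (z : ℂ),
    ‖z‖ = Real.pi * (2 * n + 1) → κ * Real.exp |z.im| ≤ ‖(x : ℂ) - Complex.cos z‖ := by
  have hπ := Real.pi_pos
  obtain ⟨κ, hκ, h⟩ := exists_mul_exp_le_norm_sin (δ := Real.pi / 4) (by positivity)
  refine ⟨2 * κ ^ 2, by positivity, fun x hx0 hx1 n z hz => ?_⟩
  -- With `x = cos θ` the difference is a product of two sines at `(±θ + z)/2`. The half arguments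
  -- stay at distance at least `π/4` from `πℤ`, uniformly in `x`.
  set θ := Real.arccos x with hθ
  have hθ0 : |θ| ≤ Real.pi / 2 := by
    rw [abs_of_nonneg (Real.arccos_nonneg x)]
    exact Real.arccos_le_pi_div_two.2 hx0.le
  have hcos : (x : ℂ) = Complex.cos θ := by
    rw [← Complex.ofReal_cos, Real.cos_arccos (by linarith) hx1.le]
  have key : ∀ y : ℝ, |y| ≤ Real.pi / 2 →
      κ * Real.exp (|z.im| / 2) ≤ ‖Complex.sin ((y + z) / 2)‖ := by
    intro y hy
    have him : |((y + z) / 2 : ℂ).im| = |z.im| / 2 := by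
      simp [abs_div]
    rw [← him]
    refine h _ fun k => ?_
    have h1 : ((y + z) / 2 - Real.pi * k : ℂ) = (z - (2 * Real.pi * k - y : ℝ)) / 2 := by
      push_cast; ring
    rw [h1, norm_div, Complex.norm_ofNat]
    have h2 := abs_norm_sub_norm_le z ((2 * Real.pi * k - y : ℝ) : ℂ)
    rw [hz, Complex.norm_real, Real.norm_eq_abs] at h2
    have h3 := abs_abs_sub_abs_le (2 * Real.pi * k - y) (2 * Real.pi * k)
    rw [sub_sub_cancel_left, abs_neg, abs_mul (2 * Real.pi), abs_of_pos (by positivity : 0 < 2 * Real.pi),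
      ← Int.cast_abs] at h3
    -- An odd integer minus an even one has absolute value at least `1`. The shift by `y` then costs
    -- at most `π/2`.
    have h4 : Real.pi ≤ |Real.pi * (2 * n + 1) - 2 * Real.pi * ((|k| : ℤ) : ℝ)| := by
      have : Real.pi * (2 * n + 1) - 2 * Real.pi * ((|k| : ℤ) : ℝ) =
          Real.pi * ((2 * n + 1 - 2 * |k| : ℤ) : ℝ) := by push_cast; ring
      rw [this, abs_mul, abs_of_pos hπ, ← Int.cast_abs]
      have h5 : (1 : ℝ) ≤ ((abs (2 * n + 1 - 2 * abs k) : ℤ) : ℝ) := by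
        exact_mod_cast Int.one_le_abs (by omega)
      nlinarith
    have h6 := abs_sub_abs_le_abs_sub (Real.pi * (2 * n + 1) - 2 * Real.pi * ((|k| : ℤ) : ℝ))
      (|2 * Real.pi * k - y| - 2 * Real.pi * ((|k| : ℤ) : ℝ))
    rw [sub_sub_sub_cancel_right] at h6
    linarith
  rw [hcos, Complex.cos_sub_cos, norm_mul, norm_mul, norm_neg, Complex.norm_ofNat]
  have h1 := key θ hθ0
  have h2 := key (-θ) (by rwa [abs_neg])
  have h3 : ‖Complex.sin ((θ - z) / 2)‖ = ‖Complex.sin (((-θ : ℝ) + z) / 2)‖ := by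
    rw [← norm_neg, ← Complex.sin_neg]
    congr 2
    push_cast; ring
  rw [h3]
  have h4 : Real.exp |z.im| = Real.exp (|z.im| / 2) * Real.exp (|z.im| / 2) := by
    rw [← Real.exp_add, add_halves]
  rw [h4]
  calc _ = 2 * (κ * Real.exp (|z.im| / 2)) * (κ * Real.exp (|z.im| / 2)) := by ring
    _ ≤ _ := by gcongr

section Decomposition
variable {N N₀ : ℕ} {M : ℂ → Matrix (Fin N) (Fin N) ℂ} {τ : Fin N → ℂ → ℂ}
  {ω : Fin N₀ → Finset (Fin N)} {Φ : Fin N₀ → Polynomial entireFunctions}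

lemma lyapunov_sub_cos_isLittleO (hM : IsMonodromyZero M)
    (hdec : IsLyapunovDecomposition M τ ω Φ) (j : Fin N) :
    (fun z => lyapunov τ j z - Complex.cos z) =o[cocompact ℂ] fun z => Real.exp |z.im| := by
  refine isLittleO_iff.2 fun δ hδ => ?_
  filter_upwards [hM.cos_asymp δ hδ] with z hz
  rw [Real.norm_of_nonneg (Real.exp_pos _).le]
  exact hz _ (isRoot_charpoly hdec j z)

lemma tendsto_conj_cocompact : Tendsto (conj : ℂ → ℂ) (cocompact ℂ) (cocompact ℂ) :=
  Complex.conjCLE.toHomeomorph.isClosedEmbedding.tendsto_cocompact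

/-- A zero of `Φ_s(x, ·)` forces a multiplier of modulus one, so it is real. Both this function and
its reflection are asymptotic to `(x - cos z)^{N_s}` on the circles `|z| = π(2n + 1)`. -/
lemma conj_eval_map_evalAt (hM : IsMonodromyZero M) (hdec : IsLyapunovDecomposition M τ ω Φ)
    (s : Fin N₀) {x : ℝ} (hx0 : 0 < x) (hx1 : x < 1) (z : ℂ) :
    conj (((Φ s).map (entireFunctions.evalAt (conj z))).eval (x : ℂ)) =
      ((Φ s).map (entireFunctions.evalAt z)).eval (x : ℂ) := by
  set F : ℂ → ℂ := fun z => ((Φ s).map (entireFunctions.evalAt z)).eval (x : ℂ) with hF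
  have hFprod : ∀ z, F z = ∏ j ∈ ω s, ((x : ℂ) - lyapunov τ j z) := by
    intro z
    simp only [hF, hdec.branches, eval_prod]
    simp
  obtain ⟨κ, hκ, hlow⟩ := exists_mul_exp_le_norm_cos_sub
  set R : ℕ → ℝ := fun n => Real.pi * (2 * n + 1) with hRdef
  -- Infinity is approached only along the circles on which `x - cos z` is bounded below.
  set l : Filter ℂ := cocompact ℂ ⊓ 𝓟 {z | ∃ n, ‖z‖ = R n} with hl
  have hlow' : ∀ᶠ z in l, κ * Real.exp |z.im| ≤ ‖(x : ℂ) - Complex.cos z‖ := by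
    refine eventually_inf_principal.2 (Eventually.of_forall ?_)
    rintro z ⟨n, hn⟩
    exact hlow x hx0 hx1 n z hn
  have hratio : ∀ D : ℂ → ℂ, (fun z => D z - Complex.cos z) =o[cocompact ℂ]
      (fun z => Real.exp |z.im|) →
      Tendsto (fun z => ((x : ℂ) - D z) / ((x : ℂ) - Complex.cos z)) l (𝓝 1) := by
    intro D hD
    have h1 : (fun z => D z - Complex.cos z) =o[l] fun z => (x : ℂ) - Complex.cos z := by
      refine (hD.mono inf_le_left).trans_isBigO (IsBigO.of_bound κ⁻¹ ?_)
      filter_upwards [hlow'] with z hz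
      rw [Real.norm_of_nonneg (Real.exp_pos _).le, ← div_eq_inv_mul, le_div_iff₀ hκ, mul_comm]
      exact hz
    have h2 := (h1.tendsto_div_nhds_zero).const_sub 1
    rw [sub_zero] at h2
    refine h2.congr' ?_
    filter_upwards [hlow'] with z hz
    have : (x : ℂ) - Complex.cos z ≠ 0 := by
      rw [← norm_pos_iff]
      exact lt_of_lt_of_le (by positivity) hz
    field_simp
    ring
  have hΔ := lyapunov_sub_cos_isLittleO hM hdec
  have hΔc : ∀ j, (fun z => conj (lyapunov τ j (conj z)) - Complex.cos z) =o[cocompact ℂ]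
      fun z => Real.exp |z.im| := by
    intro j
    have := (hΔ j).comp_tendsto tendsto_conj_cocompact
    refine (this.norm_left.congr (fun z => ?_) fun z => ?_).of_norm_left
    · rw [Function.comp_apply, ← Complex.norm_conj, map_sub, Complex.cos_conj, Complex.conj_conj]
    · simp
  have ht1 : Tendsto (fun z => F z / ((x : ℂ) - Complex.cos z) ^ (ω s).card) l (𝓝 1) := by
    have := tendsto_finsetProd (ω s) fun j _ => hratio _ (hΔ j)
    simpa only [hFprod, Finset.prod_div_distrib, Finset.prod_const, Finset.prod_const_one,
      one_pow] using this
  have ht2 : Tendsto (fun z => conj (F (conj z)) / ((x : ℂ) - Complex.cos z) ^ (ω s).card) l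
      (𝓝 1) := by
    have := tendsto_finsetProd (ω s) fun j _ => hratio _ (hΔc j)
    simpa only [hFprod, Finset.prod_div_distrib, Finset.prod_const, Finset.prod_const_one,
      one_pow, map_prod, map_sub, Complex.conj_ofReal] using this
  have ht3 := ((ht2.div ht1 one_ne_zero).sub_const 1).norm
  rw [div_one, sub_self, norm_zero] at ht3
  have hRt : Tendsto R atTop atTop := by
    refine Tendsto.const_mul_atTop Real.pi_pos ?_
    exact tendsto_atTop_add_const_right _ _
      (tendsto_natCast_atTop_atTop.const_mul_atTop (by norm_num))
  refine conj_apply_conj_of_real_zeros (differentiable_eval_map _ _) (fun w hw => ?_) (R := R) ?_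
    (fun ε hε => ?_) z
  · change F w = 0 at hw
    rw [hFprod, Finset.prod_eq_zero_iff] at hw
    obtain ⟨j, -, hj⟩ := hw
    exact hM.multiplier_real w _ (isRoot_charpoly hdec j w)
      (norm_eq_one_of_half_add_inv hx0 hx1 (sub_eq_zero.1 hj).symm)
  · exact hRt
  · have h1 : ∀ᶠ z in l, F z ≠ 0 ∧ ‖conj (F (conj z)) / F z - 1‖ ≤ ε := by
      filter_upwards [ht3.eventually_le_const hε, ht1.eventually_ne one_ne_zero, hlow']
        with z h1 h2 h3
      have h4 : ((x : ℂ) - Complex.cos z) ^ (ω s).card ≠ 0 := by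
        refine pow_ne_zero _ (norm_pos_iff.1 (lt_of_lt_of_le (by positivity) h3))
      have h5 : F z ≠ 0 := fun h => h2 (by rw [h, zero_div])
      simp only [Pi.div_apply] at h1
      rw [div_div_div_cancel_right₀ h4] at h1
      exact ⟨h5, h1⟩
    rw [hl, eventually_inf_principal, ← Metric.cobounded_eq_cocompact,
      ← comap_norm_atTop, eventually_comap] at h1
    filter_upwards [hRt.eventually h1] with n hn w hw
    exact hn w (by simpa using hw) ⟨n, by simpa using hw⟩

/-- The component `Φ_s` is real on the real line. -/
lemma map_conj_map_evalAt (hM : IsMonodromyZero M) (hdec : IsLyapunovDecomposition M τ ω Φ)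
    (s : Fin N₀) (z : ℂ) :
    ((Φ s).map (entireFunctions.evalAt (conj z))).map (conj : ℂ →+* ℂ) =
      (Φ s).map (entireFunctions.evalAt z) := by
  refine eq_of_infinite_eval_eq _ _ (Set.Infinite.mono (s := (fun x : ℝ => (x : ℂ)) '' Set.Ioo 0 1)
    ?_ ((Set.Ioo_infinite one_pos).image Complex.ofReal_injective.injOn))
  rintro _ ⟨x, hx, rfl⟩
  have h := conj_eval_map_evalAt hM hdec s hx.1 hx.2 z
  simp only [Set.mem_ofPred_eq]
  rw [← h, ← eval_map_apply, Complex.conj_ofReal]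

/-- The discriminant inherits the symmetry of `Φ_s`. This carries information from the upper
half-plane to the lower one. -/
lemma resonanceFun_conj (hM : IsMonodromyZero M) (hdec : IsLyapunovDecomposition M τ ω Φ)
    (s : Fin N₀) (z : ℂ) :
    resonanceFun τ (ω s) (conj z) = conj (resonanceFun τ (ω s) z) := by
  have h := map_conj_map_evalAt hM hdec s (conj z)
  rw [Complex.conj_conj] at h
  rw [resonanceFun_eq_resultant hdec, resonanceFun_eq_resultant hdec, ← h, derivative_map,
    resultant_map_map, map_mul, map_pow, map_neg, map_one]

end Decomposition

/-! ### Asymptotics of `ρ_s`. -/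

lemma isLittleO_prod_sub_prod {α ι : Type*} {l : Filter α} {E : α → ℝ} (S : Finset ι)
    {f g : ι → α → ℂ} (hf : ∀ i ∈ S, f i =O[l] E)
    (hg : ∀ i ∈ S, (fun x => g i x - f i x) =o[l] E) :
    (fun x => ∏ i ∈ S, f i x) =O[l] (fun x => E x ^ S.card) ∧
    (fun x => ∏ i ∈ S, g i x - ∏ i ∈ S, f i x) =o[l] fun x => E x ^ S.card := by
  classical
  induction S using Finset.induction_on with
  | empty =>
    simp only [Finset.prod_empty, Finset.card_empty, pow_zero, sub_self]
    exact ⟨isBigO_const_const _ one_ne_zero _, isLittleO_zero _ _⟩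
  | insert a S ha ih =>
    obtain ⟨ih1, ih2⟩ := ih (fun i hi => hf i (by simp [hi])) fun i hi => hg i (by simp [hi])
    have ha1 := hf a (by simp)
    have ha2 := hg a (by simp)
    simp only [Finset.prod_insert ha, Finset.card_insert_of_notMem ha, pow_succ']
    refine ⟨ha1.mul ih1, ?_⟩
    have h3 : g a =O[l] E := by simpa using ha2.isBigO.add ha1
    refine ((h3.mul_isLittleO ih2).add (ha2.mul_isBigO ih1)).congr_left fun x => ?_
    ring

/-- Some `m`-th root of `P` is close to `s` if `P` is close to `s ^ m`. -/
lemma exists_pow_eq_norm_sub_pow_le {m : ℕ} (hm : m ≠ 0) (s P : ℂ) :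
    ∃ w, w ^ m = P ∧ ‖w - s‖ ^ m ≤ ‖s ^ m - P‖ := by
  -- The product of the distances from `s` to the `m` roots of `X^m - P` equals `|s^m - P|`, so not
  -- all of them can exceed its `m`-th root.
  by_contra! h
  set Q : ℂ[X] := X ^ m - C P with hQ
  have hmonic : Q.Monic := monic_X_pow_sub_C P hm
  have hdeg : Q.natDegree = m := natDegree_X_pow_sub_C
  have hsplit := IsAlgClosed.splits Q
  have h1 : Q = (Q.roots.map fun a => X - C a).prod := by
    conv_lhs => rw [hsplit.eq_prod_roots, hmonic.leadingCoeff, C_1, one_mul]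
  have hcard : Multiset.card Q.roots = m := by rw [← hsplit.natDegree_eq_card_roots, hdeg]
  have h2 : ∀ w ∈ Q.roots, ‖s ^ m - P‖ < ‖s - w‖ ^ m := by
    intro w hw
    rw [norm_sub_rev s w]
    refine h w ?_
    have := isRoot_of_mem_roots hw
    simpa [hQ, sub_eq_zero] using this
  have h3 : s ^ m - P = (Q.roots.map fun a => s - a).prod := by
    have := congr_arg (eval s) h1
    rw [eval_multiset_prod, Multiset.map_map] at this
    simpa [hQ] using this
  have h4 : ((‖s ^ m - P‖ : ℝ) ^ ((1 : ℝ) / m)) ^ m = ‖s ^ m - P‖ := by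
    rw [← Real.rpow_natCast, ← Real.rpow_mul (norm_nonneg _), one_div,
      inv_mul_cancel₀ (by exact_mod_cast hm), Real.rpow_one]
  set r := (‖s ^ m - P‖ : ℝ) ^ ((1 : ℝ) / m)
  have hr : 0 ≤ r := by positivity
  obtain ⟨w₀, hw₀⟩ := Multiset.card_pos_iff_exists_mem.1
    (by rw [hcard]; omega : 0 < Multiset.card Q.roots)
  obtain ⟨t, hrt, ht⟩ : ∃ t, r < t ∧ ∀ w ∈ Q.roots, t ≤ ‖s - w‖ := by
    obtain ⟨w, hw, hmin⟩ := Q.roots.toFinset.exists_min_image (fun w => ‖s - w‖)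
      ⟨w₀, Multiset.mem_toFinset.2 hw₀⟩
    refine ⟨‖s - w‖, lt_of_pow_lt_pow_left₀ m (norm_nonneg _) ?_, fun v hv =>
      hmin v (Multiset.mem_toFinset.2 hv)⟩
    rw [h4]
    exact h2 w (Multiset.mem_toFinset.1 hw)
  have h5 := le_norm_prod_sub (hr.trans hrt.le) ht
  rw [← h3, hcard] at h5
  have h6 := pow_lt_pow_left₀ hrt hr hm
  rw [h4] at h6
  linarith

section Asymptotics
variable {N : ℕ} {τ : Fin N → ℂ → ℂ} {b : Fin N → ℂ} {ω : Finset (Fin N)}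

lemma resonanceConst_ne_zero (hb : ∀ j ∈ ω, ∀ k ∈ ω, j ≠ k → b j ≠ b k) :
    resonanceConst b ω ≠ 0 := by
  refine Finset.prod_ne_zero_iff.2 fun p hp => pow_ne_zero _ (sub_ne_zero.2 ?_)
  simp only [orderedPairs, Finset.mem_filter, Finset.mem_product] at hp
  exact hb _ hp.1.1 _ hp.1.2 hp.2.ne

lemma isBigO_sin (l : Filter ℂ) : Complex.sin =O[l] fun z => Real.exp |z.im| :=
  IsBigO.of_bound 1 <| Eventually.of_forall fun z => by
    simpa [Real.norm_of_nonneg (Real.exp_pos _).le] using norm_sin_le_exp z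

lemma isBigO_cos (l : Filter ℂ) : Complex.cos =O[l] fun z => Real.exp |z.im| :=
  IsBigO.of_bound 1 <| Eventually.of_forall fun z => by
    simpa [Real.norm_of_nonneg (Real.exp_pos _).le] using norm_cos_le_exp z

/-- In each difference `Δ_j - Δ_k` the cosines cancel. Twice the number of pairs is `N_s(N_s - 1)`,
the common exponent. -/
lemma isLittleO_resonanceFun_sub {l : Filter ℂ} (hl : ∀ᶠ z in l, z ≠ 0)
    (hb : ∀ j ∈ ω, ∀ k ∈ ω, j ≠ k → b j ≠ b k)
    (hasymp : ∀ j ∈ ω, HasLyapunovAsymptotics l (lyapunov τ j) (b j)) :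
    (fun z => (2 * z) ^ (ω.card * (ω.card - 1)) * resonanceFun τ ω z / resonanceConst b ω -
      Complex.sin z ^ (ω.card * (ω.card - 1))) =o[l]
      fun z => Real.exp |z.im| ^ (ω.card * (ω.card - 1)) := by
  have hc := resonanceConst_ne_zero hb
  have hpair : ∀ p ∈ orderedPairs ω, (fun z => 2 * z * (lyapunov τ p.1 z - lyapunov τ p.2 z) -
      (b p.1 - b p.2) * Complex.sin z) =o[l] fun z => Real.exp |z.im| := by
    intro p hp
    simp only [orderedPairs, Finset.mem_filter, Finset.mem_product] at hp
    obtain ⟨ε₁, h1, h1'⟩ := hasymp _ hp.1.1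
    obtain ⟨ε₂, h2, h2'⟩ := hasymp _ hp.1.2
    refine (h1.sub h2).congr' ?_ EventuallyEq.rfl
    filter_upwards [h1', h2', hl] with z e1 e2 hz
    rw [e1, e2]
    field_simp
    ring
  obtain ⟨hO, ho⟩ := isLittleO_prod_sub_prod (orderedPairs ω)
    (f := fun p z => (b p.1 - b p.2) * Complex.sin z)
    (g := fun p z => 2 * z * (lyapunov τ p.1 z - lyapunov τ p.2 z))
    (fun p _ => (isBigO_sin l).const_mul_left _) hpair
  -- This bounds the second factor in `P² - Q² = (P - Q)((P - Q) + 2Q)`.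
  have hO' := ho.isBigO.add (hO.const_mul_left 2)
  refine ((ho.mul_isBigO hO').const_mul_left (resonanceConst b ω)⁻¹).congr (fun z => ?_)
    fun z => ?_
  · have h1 : (2 * z) ^ (ω.card * (ω.card - 1)) * resonanceFun τ ω z =
        (∏ p ∈ orderedPairs ω, 2 * z * (lyapunov τ p.1 z - lyapunov τ p.2 z)) ^ 2 := by
      rw [Finset.prod_mul_distrib, Finset.prod_const, mul_pow _ _ 2, ← pow_mul, mul_comm _ 2,
        card_orderedPairs, resonanceFun, Finset.prod_pow]
    have h2 : resonanceConst b ω * Complex.sin z ^ (ω.card * (ω.card - 1)) =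
        (∏ p ∈ orderedPairs ω, (b p.1 - b p.2) * Complex.sin z) ^ 2 := by
      rw [Finset.prod_mul_distrib, Finset.prod_const, mul_pow _ _ 2, ← pow_mul, mul_comm _ 2,
        card_orderedPairs, resonanceConst, Finset.prod_pow]
    rw [h1, eq_sub_iff_add_eq, eq_div_iff hc, add_mul, mul_comm _ (resonanceConst b ω),
      mul_comm _ (resonanceConst b ω), h2, mul_inv_cancel_left₀ hc]
    ring
  · rw [← card_orderedPairs, ← pow_add, two_mul]

lemma eventually_imAtTop_le_norm_sin :
    ∃ κ > 0, ∀ᶠ z in imAtTop, z ≠ 0 ∧ κ * Real.exp |z.im| ≤ ‖Complex.sin z‖ := by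
  obtain ⟨κ, hκ, h⟩ := exists_mul_exp_le_norm_sin one_pos
  refine ⟨κ, hκ, ?_⟩
  have h1 : ∀ᶠ z in imAtTop, 1 ≤ z.im := tendsto_comap.eventually (eventually_ge_atTop 1)
  filter_upwards [h1] with z hz
  refine ⟨by rintro rfl; norm_num at hz, h z fun n => ?_⟩
  have := Complex.abs_im_le_norm (z - Real.pi * n)
  have h2 : (z - Real.pi * n).im = z.im := by simp
  rw [h2] at this
  exact (hz.trans (le_abs_self _)).trans this

lemma resonanceFun_asymptotics_imAtTop (hb : ∀ j ∈ ω, ∀ k ∈ ω, j ≠ k → b j ≠ b k)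
    (hasymp : ∀ j ∈ ω, HasLyapunovAsymptotics imAtTop (lyapunov τ j) (b j)) :
    ∃ ε : ℂ → ℂ, Tendsto ε imAtTop (𝓝 0) ∧
      ∀ᶠ z in imAtTop, resonanceFun τ ω z = resonanceConst b ω *
          (Complex.sin z / (2 * z)) ^ (ω.card * (ω.card - 1)) * (1 + ε z) := by
  obtain ⟨κ, hκ, hsin⟩ := eventually_imAtTop_le_norm_sin
  have hc := resonanceConst_ne_zero hb
  have h := isLittleO_resonanceFun_sub (hsin.mono fun z hz => hz.1) hb hasymp
  have h1 : (fun z : ℂ => Real.exp |z.im|) =O[imAtTop] Complex.sin := by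
    refine IsBigO.of_bound κ⁻¹ ?_
    filter_upwards [hsin] with z hz
    rw [Real.norm_of_nonneg (Real.exp_pos _).le, ← div_eq_inv_mul, le_div_iff₀ hκ, mul_comm]
    exact hz.2
  refine ⟨_, (h.trans_isBigO (h1.pow _)).tendsto_div_nhds_zero, ?_⟩
  filter_upwards [hsin] with z hz
  have hs : Complex.sin z ≠ 0 := norm_pos_iff.1 (lt_of_lt_of_le (by positivity) hz.2)
  have h2z : 2 * z ≠ 0 := mul_ne_zero two_ne_zero hz.1
  generalize ω.card * (ω.card - 1) = m
  have h1 := pow_ne_zero m hs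
  have h2 := pow_ne_zero m h2z
  rw [div_pow]
  generalize (2 * z) ^ m = u at *
  field_simp
  ring

/-- Near the zeros of the sine no relative error is available. Instead, at each point the `m`-th
root of `(2z)^m ρ_s / c_s` closest to `sin z` is used; the `m`-th power of its error is `o(e^{m|Im
z|})`. -/
lemma resonanceFun_asymptotics_cocompact (hb : ∀ j ∈ ω, ∀ k ∈ ω, j ≠ k → b j ≠ b k)
    (hasymp : ∀ j ∈ ω, HasLyapunovAsymptotics (cocompact ℂ) (lyapunov τ j) (b j)) :
    ∃ ε : ℂ → ℂ, ε =o[cocompact ℂ] (fun z => Real.exp |z.im|) ∧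
      ∀ᶠ z in cocompact ℂ, resonanceFun τ ω z = resonanceConst b ω *
          ((Complex.sin z + ε z) / (2 * z)) ^ (ω.card * (ω.card - 1)) := by
  have hc := resonanceConst_ne_zero hb
  have hl : ∀ᶠ z in cocompact ℂ, z ≠ (0 : ℂ) :=
    (isCompact_singleton (x := (0 : ℂ))).compl_mem_cocompact
  have h := isLittleO_resonanceFun_sub hl hb hasymp
  -- For exponent zero there is no root to extract, but there are no pairs either and both sides are
  -- `1`.
  rcases eq_or_ne (ω.card * (ω.card - 1)) 0 with hm | hm
  · refine ⟨0, isLittleO_zero _ _, Eventually.of_forall fun z => ?_⟩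
    have h2 := card_orderedPairs ω
    have h3 : orderedPairs ω = ∅ := Finset.card_eq_zero.1 (by omega)
    simp [hm, resonanceFun, resonanceConst, h3]
  · generalize ω.card * (ω.card - 1) = m at *
    choose w hw hws using fun z => exists_pow_eq_norm_sub_pow_le hm (Complex.sin z)
      ((2 * z) ^ m * resonanceFun τ ω z / resonanceConst b ω)
    refine ⟨fun z => w z - Complex.sin z, ?_, ?_⟩
    · refine IsLittleO.of_pow (n := m) (IsBigO.trans_isLittleO ?_ h) hm
      refine IsBigO.of_bound 1 (Eventually.of_forall fun z => ?_)
      rw [Pi.pow_apply, norm_pow, one_mul, norm_sub_rev _ (Complex.sin z ^ m)]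
      exact hws z
    · filter_upwards [hl] with z hz
      rw [add_sub_cancel, div_pow, hw]
      field_simp

end Asymptotics

/-! ### Membership in the Cartwright class. -/

section Decomposition
variable {N N₀ : ℕ} {M : ℂ → Matrix (Fin N) (Fin N) ℂ} {τ : Fin N → ℂ → ℂ}
  {ω : Fin N₀ → Finset (Fin N)} {Φ : Fin N₀ → Polynomial entireFunctions}

/-- The class `𝓜_N⁰` gives `Δ_j = O(e^{|Im z|})` in all directions, which is enough for exponential
type and for boundedness on the real line. -/
lemma exists_norm_resonanceFun_le (hM : IsMonodromyZero M)
    (hdec : IsLyapunovDecomposition M τ ω Φ) (s : Fin N₀) :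
    ∃ A > 0, ∀ z, ‖resonanceFun τ (ω s) z‖ ≤
      A * Real.exp |z.im| ^ ((ω s).card * ((ω s).card - 1)) := by
  have h1 : ∀ j, lyapunov τ j =O[cocompact ℂ] fun z => Real.exp |z.im| := by
    intro j
    simpa using (lyapunov_sub_cos_isLittleO hM hdec j).isBigO.add (isBigO_cos _)
  have h2 : resonanceFun τ (ω s) =O[cocompact ℂ]
      fun z => Real.exp |z.im| ^ ((ω s).card * ((ω s).card - 1)) := by
    have := IsBigO.finsetProd (s := orderedPairs (ω s)) fun p _ => ((h1 p.1).sub (h1 p.2)).pow 2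
    refine this.congr (fun z => by rw [resonanceFun]) fun z => ?_
    rw [Finset.prod_const, ← pow_mul, card_orderedPairs]
  obtain ⟨C, hC⟩ := h2.bound
  obtain ⟨K, hK, hKC⟩ := mem_cocompact.1 hC
  obtain ⟨C', hC'⟩ := hK.exists_bound_of_continuousOn
    (differentiable_resonanceFun hdec s).continuous.continuousOn
  refine ⟨max (max C C') 1, by positivity, fun z => ?_⟩
  have hE : 1 ≤ Real.exp |z.im| ^ ((ω s).card * ((ω s).card - 1)) :=
    one_le_pow₀ (Real.one_le_exp (abs_nonneg _))
  by_cases hz : z ∈ K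
  · calc _ ≤ C' := hC' z hz
      _ ≤ max (max C C') 1 * 1 := by rw [mul_one]; exact (le_max_right _ _).trans (le_max_left _ _)
      _ ≤ _ := by gcongr
  · have h3 : ‖resonanceFun τ (ω s) z‖ ≤ _ := hKC hz
    rw [Real.norm_of_nonneg (by positivity)] at h3
    refine h3.trans ?_
    gcongr
    exact (le_max_left _ _).trans (le_max_left _ _)

/-- A function of size `exp (m y)` up to constants and a power of `y` has type `m`. -/
lemma limsup_log_div_eq {f : ℝ → ℂ} {m : ℕ} {κ₁ κ₂ : ℝ} (h1 : 0 < κ₁)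
    (hf : ∀ᶠ y : ℝ in atTop, κ₁ * Real.exp y ^ m ≤ ‖f y‖ * (2 * y) ^ m ∧
      ‖f y‖ * (2 * y) ^ m ≤ κ₂ * Real.exp y ^ m) :
    limsup (fun y : ℝ => ENNReal.log ‖f y‖ₑ / (y : EReal)) atTop = ((m : ℝ) : EReal) := by
  have hlog : Tendsto (fun y : ℝ => Real.log (2 * y) / y) atTop (𝓝 0) := by
    have h := (Real.isLittleO_log_id_atTop.tendsto_div_nhds_zero.comp
      (tendsto_id.const_mul_atTop (two_pos : (0 : ℝ) < 2))).const_mul 2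
    rw [mul_zero] at h
    refine h.congr' ?_
    filter_upwards [eventually_gt_atTop 0] with y hy
    simp only [Function.comp_apply, id]
    field_simp
  have hbd : ∀ κ : ℝ, Tendsto (fun y : ℝ => Real.log κ / y + m - m * (Real.log (2 * y) / y))
      atTop (𝓝 m) := by
    intro κ
    have h := ((tendsto_const_nhds (x := Real.log κ)).div_atTop tendsto_id).add_const (m : ℝ)
    have := h.sub (hlog.const_mul (m : ℝ))
    simpa using this
  have hpos : ∀ᶠ y : ℝ in atTop, 0 < ‖f y‖ := by
    filter_upwards [hf, eventually_gt_atTop 0] with y hy hy0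
    have h3 : 0 < ‖f y‖ * (2 * y) ^ m := lt_of_lt_of_le (by positivity) hy.1
    exact pos_of_mul_pos_left h3 (by positivity)
  have key : Tendsto (fun y : ℝ => Real.log ‖f y‖ / y) atTop (𝓝 m) := by
    refine tendsto_of_tendsto_of_tendsto_of_le_of_le' (hbd κ₁) (hbd κ₂) ?_ ?_
    · filter_upwards [hf, hpos, eventually_gt_atTop 0] with y hy hp hy0
      have := Real.log_le_log (by positivity) hy.1
      rw [Real.log_mul (by positivity) (by positivity), Real.log_mul (by positivity) (by positivity),
        Real.log_pow, Real.log_pow, Real.log_exp] at this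
      rw [← sub_nonneg, show Real.log ‖f y‖ / y - (Real.log κ₁ / y + m - m * (Real.log (2 * y) / y))
        = (Real.log ‖f y‖ - (Real.log κ₁ + m * y - m * Real.log (2 * y))) / y by field_simp]
      exact div_nonneg (by linarith) hy0.le
    · filter_upwards [hf, hpos, eventually_gt_atTop 0] with y hy hp hy0
      have hk : 0 < κ₂ := by
        have h3 : 0 < κ₂ * Real.exp y ^ m := lt_of_lt_of_le (by positivity) hy.2
        exact pos_of_mul_pos_left h3 (by positivity)
      have := Real.log_le_log (by positivity) hy.2
      rw [Real.log_mul (by positivity) (by positivity), Real.log_mul (by positivity) (by positivity),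
        Real.log_pow, Real.log_pow, Real.log_exp] at this
      rw [← sub_nonneg, show Real.log κ₂ / y + m - m * (Real.log (2 * y) / y) - Real.log ‖f y‖ / y
        = (Real.log κ₂ + m * y - m * Real.log (2 * y) - Real.log ‖f y‖) / y by field_simp]
      exact div_nonneg (by linarith) hy0.le
  refine Tendsto.limsup_eq ?_
  refine ((continuous_coe_real_ereal.tendsto _).comp key).congr' ?_
  filter_upwards [hpos] with y hy
  rw [Function.comp_apply, EReal.coe_div, ENNReal.log_pos_real (by simpa using hy) (by simp),
    toReal_enorm]

lemma isCartwright_resonanceFun (hM : IsMonodromyZero M)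
    (hdec : IsLyapunovDecomposition M τ ω Φ) (s : Fin N₀) {b : Fin N → ℂ}
    (hb : ∀ j ∈ ω s, ∀ k ∈ ω s, j ≠ k → b j ≠ b k)
    (hasymp : ∀ j ∈ ω s, HasLyapunovAsymptotics imAtTop (lyapunov τ j) (b j)) :
    IsCartwright ((ω s).card * ((ω s).card - 1) : ℝ) ((ω s).card * ((ω s).card - 1) : ℝ)
      (resonanceFun τ (ω s)) := by
  have hm : (((ω s).card * ((ω s).card - 1) : ℕ) : ℝ) =
      ((ω s).card * ((ω s).card - 1) : ℝ) := by
    rcases Nat.eq_zero_or_pos (ω s).card with h | h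
    · simp [h]
    · push_cast [Nat.cast_sub h]; ring
  have hc := resonanceConst_ne_zero hb
  rw [← hm]
  obtain ⟨A, hA, hbound⟩ := exists_norm_resonanceFun_le hM hdec s
  have hpos : limsup (fun y : ℝ => ENNReal.log ‖resonanceFun τ (ω s) (Complex.I * y)‖ₑ / (y : EReal))
      atTop = ((((ω s).card * ((ω s).card - 1) : ℕ) : ℝ) : EReal) := by
    obtain ⟨κ, hκ, hsin⟩ := eventually_imAtTop_le_norm_sin
    obtain ⟨ε, hε, hρ⟩ := resonanceFun_asymptotics_imAtTop hb hasymp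
    have hIy : Tendsto (fun y : ℝ => Complex.I * y) atTop imAtTop := by
      refine tendsto_comap_iff.2 (tendsto_id.congr fun y => ?_)
      simp
    generalize (ω s).card * ((ω s).card - 1) = m at *
    refine limsup_log_div_eq (κ₁ := ‖resonanceConst b (ω s)‖ * κ ^ m * (1 / 2))
      (κ₂ := ‖resonanceConst b (ω s)‖ * 1 * 2) (by positivity) ?_
    have hε2 : ∀ᶠ z in imAtTop, ‖ε z‖ ≤ 1 / 2 := by
      have := hε.norm
      rw [norm_zero] at this
      exact this.eventually_le_const (by norm_num)
    filter_upwards [hIy.eventually hsin, hIy.eventually hρ, hIy.eventually hε2,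
      eventually_gt_atTop 0] with y h1 h2 h3 hy
    have him : Real.exp |(Complex.I * y).im| = Real.exp y := by simp [abs_of_pos hy]
    have h4 := norm_sin_le_exp (Complex.I * y)
    rw [him] at h1 h4
    have h5 : ‖resonanceFun τ (ω s) (Complex.I * y)‖ * (2 * y) ^ m =
        ‖resonanceConst b (ω s)‖ * ‖Complex.sin (Complex.I * y)‖ ^ m *
          ‖1 + ε (Complex.I * y)‖ := by
      rw [h2, norm_mul, norm_mul, norm_pow, norm_div, div_pow, norm_mul, norm_mul, Complex.norm_I,
        Complex.norm_real, Real.norm_of_nonneg hy.le, Complex.norm_ofNat, one_mul]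
      field_simp
    have h6 : 1 / 2 ≤ ‖1 + ε (Complex.I * y)‖ := by
      have := norm_sub_norm_le (1 : ℂ) (-ε (Complex.I * y))
      rw [norm_neg, sub_neg_eq_add, norm_one] at this
      linarith
    have h7 : ‖1 + ε (Complex.I * y)‖ ≤ 2 := by
      have := norm_add_le (1 : ℂ) (ε (Complex.I * y))
      rw [norm_one] at this
      linarith
    have h8 : κ ^ m * Real.exp y ^ m ≤ ‖Complex.sin (Complex.I * y)‖ ^ m := by
      rw [← mul_pow]
      exact pow_le_pow_left₀ (by positivity) h1.2 m
    rw [h5]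
    constructor
    · calc _ = ‖resonanceConst b (ω s)‖ * (κ ^ m * Real.exp y ^ m) * (1 / 2) := by ring
        _ ≤ _ := by gcongr
    · calc _ ≤ ‖resonanceConst b (ω s)‖ * Real.exp y ^ m * 2 := by gcongr
        _ = _ := by ring
  refine ⟨differentiable_resonanceFun hdec s, ⟨A, ((ω s).card * ((ω s).card - 1) : ℕ),
    fun z => (hbound z).trans ?_⟩, ?_, hpos, ?_⟩
  · rw [← Real.exp_nat_mul]
    gcongr
    exact Complex.abs_im_le_norm z
  · refine (integrable_inv_one_add_sq.const_mul (Real.posLog A)).mono' ?_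
      (Eventually.of_forall fun x => ?_)
    · refine Continuous.aestronglyMeasurable ?_
      have h1 := (differentiable_resonanceFun hdec s).continuous
      refine Continuous.div ?_ (by fun_prop) fun x => by positivity
      exact Real.continuous_posLog.comp ((h1.comp Complex.continuous_ofReal).norm)
    · have h1 := hbound x
      rw [Complex.ofReal_im, abs_zero, Real.exp_zero, one_pow, mul_one] at h1
      rw [Real.norm_of_nonneg (div_nonneg Real.posLog_nonneg (by positivity)), div_eq_mul_inv]
      gcongr
  -- By symmetry `|ρ_s|` takes the same values at `-iy` and `iy`.
  · rw [← hpos]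
    congr 1
    ext y
    have h1 : -(Complex.I * y) = conj (Complex.I * y) := by simp
    rw [h1, resonanceFun_conj hM hdec, RCLike.enorm_conj]

end Decomposition

/-! ### Counting and localizing the zeros. -/

section Count
variable {f : ℂ → ℂ} {c : ℂ} {m : ℕ}

lemma exists_norm_sub_sin_pow_lt (hf : (fun z => (2 * z) ^ m * f z / c - Complex.sin z ^ m)
      =o[cocompact ℂ] fun z => Real.exp |z.im| ^ m) {δ : ℝ} (hδ : 0 < δ) :
    ∃ R : ℝ, ∀ z : ℂ, R < ‖z‖ → (∀ n : ℤ, δ ≤ ‖z - Real.pi * n‖) →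
      ‖(2 * z) ^ m * f z / c - Complex.sin z ^ m‖ < ‖Complex.sin z ^ m‖ := by
  obtain ⟨κ, hκ, h⟩ := exists_mul_exp_le_norm_sin hδ
  have h1 := hf.bound (c := κ ^ m / 2) (by positivity)
  rw [← Metric.cobounded_eq_cocompact, ← comap_norm_atTop, eventually_comap] at h1
  obtain ⟨R, hR⟩ := eventually_atTop.1 h1
  refine ⟨R, fun z hz hzn => (hR _ hz.le z rfl).trans_lt ?_⟩
  have h2 := pow_le_pow_left₀ (by positivity) (h z hzn) m
  rw [norm_pow (Complex.sin z)]
  refine lt_of_lt_of_le ?_ h2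
  rw [Real.norm_of_nonneg (by positivity), mul_pow]
  have : 0 < κ ^ m * Real.exp |z.im| ^ m := by positivity
  linarith

/-- The power `sin^m` has `m(2n + 1)` zeros in the disc, and the factor `(2z)^m` accounts for `m` of
them at the origin. -/
lemma card_zeros_central (hfd : Differentiable ℂ f) (hc : c ≠ 0) {n : ℕ}
    (h : ∀ z : ℂ, ‖z‖ = Real.pi * (n + 1 / 2) →
      ‖(2 * z) ^ m * f z / c - Complex.sin z ^ m‖ < ‖Complex.sin z ^ m‖) :
    ∃ Z, HasZeros f 0 (Real.pi * (n + 1 / 2)) Z ∧ Multiset.card Z = 2 * m * n := by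
  have hR : 0 < Real.pi * (n + 1 / 2) := by have := Real.pi_pos; positivity
  obtain ⟨Z, hZ⟩ := exists_hasZeros hfd (c := 0) hR fun z hz => by
    intro h0
    have := h z (by simpa using hz)
    rw [h0, mul_zero, zero_div, zero_sub, norm_neg] at this
    exact lt_irrefl _ this
  obtain ⟨W, hW, hWc⟩ := exists_hasZeros_sin_zero n
  have h1 : HasZeros (fun z : ℂ => z - 0) 0 (Real.pi * (n + 1 / 2)) {0} :=
    HasZeros.sub_const (by simpa using hR)
  have h2 := ((HasZeros.const (c := 0) (R := Real.pi * (n + 1 / 2))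
    (div_ne_zero (pow_ne_zero m (two_ne_zero (α := ℂ))) hc)).mul (h1.pow m)).mul hZ
  have h3 := HasZeros.card_eq_of_norm_sub_lt hR h2 (hW.pow m) fun z hz => by
    convert h z (by simpa using hz) using 3
    rw [sub_zero, mul_pow]
    ring
  simp only [Multiset.card_add, Multiset.card_nsmul, Multiset.card_zero, Multiset.card_singleton,
    hWc] at h3
  refine ⟨Z, hZ, ?_⟩
  nlinarith

/-- For `n ≠ 0` the factor `(2z)^m` has no zero in the disc, so all `m` zeros belong to `f`. -/
lemma card_zeros_pi_mul (hfd : Differentiable ℂ f) (hc : c ≠ 0) {n : ℤ} (hn : n ≠ 0)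
    (h : ∀ z : ℂ, ‖z - Real.pi * n‖ = Real.pi / 2 →
      ‖(2 * z) ^ m * f z / c - Complex.sin z ^ m‖ < ‖Complex.sin z ^ m‖) :
    ∃ Z, HasZeros f (Real.pi * n) (Real.pi / 2) Z ∧ Multiset.card Z = m := by
  have hπ := Real.pi_pos
  have hR : 0 < Real.pi / 2 := by positivity
  obtain ⟨Z, hZ⟩ := exists_hasZeros hfd (c := Real.pi * n) hR fun z hz => by
    intro h0
    have := h z (by simpa [dist_eq_norm] using hz)
    rw [h0, mul_zero, zero_div, zero_sub, norm_neg] at this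
    exact lt_irrefl _ this
  obtain ⟨W, hW, hWc⟩ := exists_hasZeros_sin_pi_mul n
  have h1 : HasZeros (fun z : ℂ => z) (Real.pi * n) (Real.pi / 2) 0 := by
    refine ⟨by simp, fun z => z, by fun_prop, fun z hz h0 => ?_, by simp⟩
    subst h0
    rw [mem_closedBall_iff_norm, zero_sub, norm_neg] at hz
    have := pi_le_norm_pi_mul_int_sub hn
    rw [Int.cast_zero, mul_zero, sub_zero] at this
    linarith
  have h2 := ((HasZeros.const (c := Real.pi * n) (R := Real.pi / 2)
    (div_ne_zero (pow_ne_zero m (two_ne_zero (α := ℂ))) hc)).mul (h1.pow m)).mul hZ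
  have h3 := HasZeros.card_eq_of_norm_sub_lt hR h2 (hW.pow m) fun z hz => by
    convert h z (by simpa [dist_eq_norm] using hz) using 3
    rw [mul_pow]
    ring
  simp only [Multiset.card_add, Multiset.card_nsmul, Multiset.card_zero,
    hWc] at h3
  refine ⟨Z, hZ, ?_⟩
  linarith

/-- Counting the zeros of an entire function close to `c (sin z / (2 z)) ^ m`. -/
lemma exists_zero_count (hfd : Differentiable ℂ f) (hc : c ≠ 0)
    (hf : (fun z => (2 * z) ^ m * f z / c - Complex.sin z ^ m)
      =o[cocompact ℂ] fun z => Real.exp |z.im| ^ m) :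
    ∃ n₀ : ℕ, 1 ≤ n₀ ∧
      (∃ Z, HasZeros f 0 (Real.pi * (n₀ + 1 / 2)) Z ∧ Multiset.card Z = 2 * m * n₀) ∧
      (∀ n : ℤ, (n₀ : ℤ) < |n| →
        ∃ Z, HasZeros f (Real.pi * n) (Real.pi / 2) Z ∧ Multiset.card Z = m) ∧
      ∀ z : ℂ, f z = 0 → ‖z‖ < Real.pi * (n₀ + 1 / 2) ∨
        ∃ n : ℤ, (n₀ : ℤ) < |n| ∧ ‖z - Real.pi * n‖ < Real.pi / 2 := by
  have hπ := Real.pi_pos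
  obtain ⟨R, hR⟩ := exists_norm_sub_sin_pow_lt hf (half_pos hπ)
  obtain ⟨n₀, hn₀⟩ := exists_nat_gt (max R 1)
  have h1 : 1 < n₀ := by exact_mod_cast (le_max_right _ _).trans_lt hn₀
  have h2 : R < n₀ := (le_max_left _ _).trans_lt hn₀
  have h3 : ∀ z : ℂ, Real.pi * (n₀ + 1 / 2) ≤ ‖z‖ → R < ‖z‖ := by
    intro z hz
    have : (1 : ℝ) ≤ Real.pi := by linarith [Real.pi_gt_three]
    nlinarith
  have h4 : ∀ (n : ℤ) (z : ℂ), (n₀ : ℤ) < |n| → ‖z - Real.pi * n‖ ≤ Real.pi / 2 →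
      Real.pi * (n₀ + 1 / 2) ≤ ‖z‖ := by
    intro n z hn hz
    have h5 : (n₀ : ℝ) + 1 ≤ ((|n| : ℤ) : ℝ) := by exact_mod_cast hn
    have h6 := norm_sub_norm_le (Real.pi * n : ℂ) z
    rw [norm_sub_rev, norm_pi_mul_int] at h6
    nlinarith
  refine ⟨n₀, h1.le, card_zeros_central hfd hc fun z hz => ?_, fun n hn =>
    card_zeros_pi_mul hfd hc ?_ fun z hz => ?_, fun z hz => ?_⟩
  · exact hR z (h3 z hz.ge) (le_norm_sub_of_norm_eq hz)
  · rintro rfl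
    simp only [abs_zero] at hn
    omega
  · exact hR z (h3 z (h4 n z hn hz.le)) (le_norm_sub_of_mem_sphere hz)
  · by_contra! hcon
    obtain ⟨hz1, hz2⟩ := hcon
    -- A zero outside all the discs would be far from `πℤ`, where the strict comparison with `sin^m`
    -- excludes zeros.
    have h5 : ∀ n : ℤ, Real.pi / 2 ≤ ‖z - Real.pi * n‖ := by
      intro n
      by_contra! hn
      refine absurd (hz2 n ?_) (not_le.2 hn)
      have h6 := norm_sub_norm_le z (Real.pi * n)
      rw [norm_pi_mul_int] at h6
      have h7 : (n₀ : ℝ) < ((|n| : ℤ) : ℝ) := by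
        by_contra! h8
        nlinarith
      exact_mod_cast h7
    have h6 := hR z (h3 z hz1) h5
    rw [hz, mul_zero, zero_div, zero_sub, norm_neg] at h6
    exact lt_irrefl _ h6

/-- The distant zeros are close to `πℤ`. -/
lemma eventually_norm_sub_lt_of_zero
    (hf : (fun z => (2 * z) ^ m * f z / c - Complex.sin z ^ m)
      =o[cocompact ℂ] fun z => Real.exp |z.im| ^ m) {δ : ℝ} (hδ : 0 < δ) :
    ∀ᶠ n : ℤ in cofinite, ∀ z : ℂ, f z = 0 → ‖z - Real.pi * n‖ < Real.pi / 2 →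
      ‖z - Real.pi * n‖ < δ := by
  have hπ := Real.pi_pos
  obtain ⟨R, hR⟩ := exists_norm_sub_sin_pow_lt hf (lt_min hδ (half_pos hπ))
  have h1 : ∀ᶠ n : ℤ in cofinite, R + 2 < ‖(n : ℝ)‖ := by
    have := (tendsto_norm_cocompact_atTop (E := ℝ)).comp Int.tendsto_coe_cofinite
    exact this.eventually_gt_atTop _
  filter_upwards [h1] with n hn z hz hzn
  have h2 : R < ‖z‖ := by
    have h6 := norm_sub_norm_le (Real.pi * n : ℂ) z
    rw [norm_sub_rev, norm_mul, Complex.norm_real, Real.norm_of_nonneg hπ.le,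
      ← Complex.ofReal_intCast, Complex.norm_real] at h6
    have := Real.pi_gt_three
    have := Real.pi_lt_four
    rw [Complex.ofReal_intCast] at h6
    nlinarith [norm_nonneg (n : ℝ)]
  by_contra! hcon
  -- For `k ≠ n` the distance to `πk` exceeds `π/2` automatically; only `k = n` uses the assumed
  -- distance `δ`.
  have h6 := hR z h2 fun k => ?_
  · rw [hz, mul_zero, zero_div, zero_sub, norm_neg] at h6
    exact lt_irrefl _ h6
  · by_contra! hk
    have hk2 := hk.trans_le (min_le_right _ _)
    have hne : n ≠ k := by
      rintro rfl
      exact absurd (hk.trans_le (min_le_left _ _)) (not_lt.2 hcon)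
    have h7 := pi_le_norm_pi_mul_int_sub hne
    have h8 := norm_sub_le (z - Real.pi * k) (z - Real.pi * n)
    rw [sub_sub_sub_cancel_left] at h8
    linarith

end Count

/-! ### Labelling finite multisets of points. -/

section Labelling
variable {ι : Type*}

lemma exists_map_eq_of_card_eq (S : Finset ι) {Z : Multiset ℂ}
    (h : Multiset.card Z = S.card) : ∃ Y : ι → ℂ, S.val.map Y = Z := by
  classical
  induction S using Finset.induction_on generalizing Z with
  | empty => exact ⟨0, by simpa [eq_comm] using h⟩
  | insert a S ha ih =>
    rw [Finset.card_insert_of_notMem ha] at h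
    obtain ⟨x, hx⟩ := Multiset.card_pos_iff_exists_mem.1 (by omega : 0 < Multiset.card Z)
    obtain ⟨Z', rfl⟩ := Multiset.exists_cons_of_mem hx
    rw [Multiset.card_cons, add_left_inj] at h
    obtain ⟨Y, rfl⟩ := ih h
    refine ⟨Function.update Y a x, ?_⟩
    rw [Finset.insert_val_of_notMem ha, Multiset.map_cons, Function.update_self]
    congr 1
    refine Multiset.map_congr rfl fun i hi => Function.update_of_ne ?_ _ _
    rintro rfl
    exact ha hi

/-- A labelling of `Z` as close as possible to the prescribed points `β`. -/
lemma exists_map_eq_and_closest [Finite ι] (S : Finset ι) {Z : Multiset ℂ}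
    (h : Multiset.card Z = S.card) (β : ι → ℂ) : ∃ Y : ι → ℂ, S.val.map Y = Z ∧
      ∀ Y' : ι → ℂ, S.val.map Y' = Z → ∀ r : ℝ, 0 ≤ r → (∀ i ∈ S, ‖Y' i - β i‖ ≤ r) →
        ∀ i ∈ S, ‖Y i - β i‖ ≤ r := by
  classical
  have hnorm : ∀ Y : ι → ℂ, S.val.map (fun i => if i ∈ S then Y i else 0) = S.val.map Y :=
    fun Y => Multiset.map_congr rfl fun i hi => if_pos hi
  -- Normalizing labellings to vanish off `S` leaves finitely many, so the largest distance to `β`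
  -- attains its minimum.
  have hfin : {Y : ι → ℂ | S.val.map Y = Z ∧ ∀ i ∉ S, Y i = 0}.Finite := by
    refine (Set.Finite.pi (t := fun _ : ι => (↑(insert 0 Z.toFinset) : Set ℂ))
      fun _ => Finset.finite_toSet _).subset ?_
    rintro Y ⟨hY, hY0⟩ i -
    rw [Finset.mem_coe, Finset.mem_insert, Multiset.mem_toFinset]
    by_cases hi : i ∈ S
    · exact Or.inr (hY ▸ Multiset.mem_map_of_mem Y hi)
    · exact Or.inl (hY0 i hi)
  obtain ⟨Y₀, hY₀⟩ := exists_map_eq_of_card_eq S h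
  obtain ⟨Y, hY, hmin⟩ := Set.exists_min_image _ (fun Y : ι → ℂ => S.sup fun i => ‖Y i - β i‖₊) hfin
    ⟨fun i => if i ∈ S then Y₀ i else 0, (hnorm _).trans hY₀, fun i hi => if_neg hi⟩
  refine ⟨Y, hY.1, fun Y' hY' r hr hr' i hi => ?_⟩
  lift r to NNReal using hr
  have h1 := hmin (fun i => if i ∈ S then Y' i else 0)
    ⟨(hnorm _).trans hY', fun i hi => if_neg hi⟩
  have h2 : (S.sup fun i => ‖(if i ∈ S then Y' i else 0) - β i‖₊) ≤ r := by
    refine Finset.sup_le fun i hi => ?_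
    rw [if_pos hi]
    exact hr' i hi
  exact Finset.sup_le_iff.1 (h1.trans h2) i hi

open scoped Classical in
/-- If the number of points of `Z` near each `β i` is right, then `Z` can be labelled so that each
point is close to the corresponding `β i`. -/
lemma exists_map_eq_near (S : Finset ι) {Z : Multiset ℂ}
    (h : Multiset.card Z = S.card) (β : ι → ℂ) {δ : ℝ}
    (hsep : ∀ i ∈ S, ∀ j ∈ S, β i ≠ β j → 2 * δ ≤ ‖β i - β j‖)
    (hcount : ∀ i ∈ S, Multiset.card (Z.filter (· ∈ Metric.ball (β i) δ)) =
      (S.filter fun j => β j = β i).card) :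
    ∃ Y : ι → ℂ, S.val.map Y = Z ∧ ∀ i ∈ S, ‖Y i - β i‖ < δ := by
  classical
  have hex : ∀ v : ℂ, ∃ Y : ι → ℂ, v ∈ S.image β →
      (S.filter fun j => β j = v).val.map Y = Z.filter (· ∈ Metric.ball v δ) := by
    intro v
    by_cases hv : v ∈ S.image β
    · obtain ⟨i, hi, rfl⟩ := Finset.mem_image.1 hv
      obtain ⟨Y, hY⟩ := exists_map_eq_of_card_eq _ (hcount i hi)
      exact ⟨Y, fun _ => hY⟩
    · exact ⟨0, fun h => absurd h hv⟩
  choose Y hY using hex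
  have hmem : ∀ i ∈ S, ‖Y (β i) i - β i‖ < δ := by
    intro i hi
    have h1 := hY (β i) (Finset.mem_image_of_mem β hi)
    have h2 : Y (β i) i ∈ Z.filter (· ∈ Metric.ball (β i) δ) := by
      rw [← h1]
      exact Multiset.mem_map_of_mem _ (Finset.mem_filter.2 ⟨hi, rfl⟩)
    exact mem_ball_iff_norm.1 (Multiset.mem_filter.1 h2).2
  refine ⟨fun i => Y (β i) i, ?_, hmem⟩
  -- The cardinalities agree, so inequality of counts suffices. By separation, a point `w` is used
  -- as a label only for indices sharing one value of `β`.
  refine Multiset.eq_of_le_of_card_le (Multiset.le_iff_count.2 fun w => ?_) (by simp [h])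
  by_cases hw : ∃ i ∈ S, Y (β i) i = w
  · obtain ⟨i, hi, rfl⟩ := hw
    have h1 : Multiset.count (Y (β i) i) (S.val.map fun i => Y (β i) i) =
        Multiset.count (Y (β i) i) ((S.filter fun j => β j = β i).val.map (Y (β i))) := by
      rw [Multiset.count_map, Multiset.count_map, Finset.filter_val, Multiset.filter_filter]
      congr 1
      refine Multiset.filter_congr fun j hj => ?_
      constructor
      · intro hij
        have hβ : β j = β i := by
          by_contra hne
          have h2 := hsep j hj i hi hne
          have h3 := hmem i hi
          have h4 := hmem j hj
          rw [← hij] at h4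
          have h5 := norm_sub_le (Y (β i) i - β i) (Y (β i) i - β j)
          rw [sub_sub_sub_cancel_left] at h5
          linarith
        exact ⟨by rw [← hβ, ← hij, hβ], hβ⟩
      · rintro ⟨h2, h3⟩
        rw [h3, ← h2]
    rw [h1, hY _ (Finset.mem_image_of_mem β hi)]
    exact Multiset.count_le_of_le _ (Multiset.filter_le _ _)
  · rw [Multiset.count_eq_zero_of_notMem]
    · exact Nat.zero_le _
    · rw [Multiset.mem_map]
      exact fun ⟨i, hi, h⟩ => hw ⟨i, hi, h⟩

end Labelling

/-! ### Rescaling `z = πn + w/n`. -/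

lemma tendsto_mul_zero_of_isBigO_one {α : Type*} {l : Filter α} {f g : α → ℂ}
    (hf : f =O[l] fun _ => (1 : ℝ)) (hg : Tendsto g l (𝓝 0)) :
    Tendsto (fun x => f x * g x) l (𝓝 0) := by
  have h := hf.mul_isLittleO ((isLittleO_one_iff ℝ).2 hg)
  simp only [mul_one] at h
  exact (isLittleO_one_iff ℝ).1 h

lemma tendsto_inv_fst (W : ℝ) : Tendsto (fun q : ℤ × ℂ => (q.1 : ℂ)⁻¹)
    (cofinite ×ˢ 𝓟 (Metric.closedBall (0 : ℂ) W)) (𝓝 0) := by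
  have h1 : Tendsto (fun n : ℤ => (n : ℝ)⁻¹) cofinite (𝓝 0) := by
    have := tendsto_inv₀_cobounded (α := ℝ)
    rw [Metric.cobounded_eq_cocompact] at this
    exact this.comp Int.tendsto_coe_cofinite
  have h2 := (Complex.continuous_ofReal.tendsto 0).comp (h1.comp (tendsto_fst
    (f := cofinite) (g := 𝓟 (Metric.closedBall (0 : ℂ) W))))
  refine (h2.congr fun q => ?_)
  simp

lemma isBigO_snd (W : ℝ) : (fun q : ℤ × ℂ => q.2)
    =O[cofinite ×ˢ 𝓟 (Metric.closedBall (0 : ℂ) W)] fun _ => (1 : ℝ) := by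
  refine IsBigO.of_bound W ?_
  rw [eventually_prod_principal_iff]
  refine Eventually.of_forall fun n w hw => ?_
  simpa using hw

lemma eventually_fst_ne_zero (W : ℝ) :
    ∀ᶠ q : ℤ × ℂ in cofinite ×ˢ 𝓟 (Metric.closedBall (0 : ℂ) W), (q.1 : ℂ) ≠ 0 := by
  have : ∀ᶠ n : ℤ in cofinite, (n : ℂ) ≠ 0 := by
    filter_upwards [eventually_cofinite_ne (0 : ℤ)] with n hn
    exact_mod_cast hn
  exact tendsto_fst.eventually this

lemma cos_pi_mul_int_sq (n : ℤ) : Complex.cos (Real.pi * n) ^ 2 = 1 := by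
  have h : Complex.sin (Real.pi * n) = 0 := sin_eq_zero_iff_exists_int.2 ⟨n, rfl⟩
  rw [Complex.cos_sq', h]; ring

lemma norm_cos_pi_mul_int (n : ℤ) : ‖Complex.cos (Real.pi * n)‖ = 1 := by
  have := congr_arg norm (cos_pi_mul_int_sq n)
  rw [norm_pow, norm_one] at this
  exact (pow_eq_one_iff_of_nonneg (norm_nonneg _) two_ne_zero).1 this

/-- The behaviour of `Δ` at the scale `1 / n` around `π n`. -/
lemma HasRefinedAsymptotics.tendsto {Δ : ℂ → ℂ} {b : ℂ} (h : HasRefinedAsymptotics Δ b) (W : ℝ) :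
    Tendsto (fun q : ℤ × ℂ => (q.1 : ℂ) ^ 2 * (Δ (Real.pi * q.1 + q.2 / q.1) -
      Complex.cos (Real.pi * q.1)) + Complex.cos (Real.pi * q.1) *
        ((q.2 - b / (2 * Real.pi)) ^ 2 / 2))
      (cofinite ×ˢ 𝓟 (Metric.closedBall (0 : ℂ) W)) (𝓝 0) := by
  set l := (cofinite : Filter ℤ) ×ˢ 𝓟 (Metric.closedBall (0 : ℂ) W) with hl
  have hπ : (Real.pi : ℂ) ≠ 0 := by exact_mod_cast Real.pi_ne_zero
  have hinv := tendsto_inv_fst W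
  have hw := isBigO_snd W
  have hn0 := eventually_fst_ne_zero W
  rw [← hl] at hinv hw hn0
  -- Here `D = z/n`, and below `T` is defined by `z - b/(2z) = πn + T/n`; it tends to `x = w -
  -- b/(2π)`.
  set D : ℤ × ℂ → ℂ := fun q => Real.pi + q.2 * ((q.1 : ℂ)⁻¹ * (q.1 : ℂ)⁻¹) with hD
  have hDlim : Tendsto D l (𝓝 Real.pi) := by
    have h1 := tendsto_mul_zero_of_isBigO_one hw (by simpa using hinv.mul hinv)
    simpa using h1.const_add (Real.pi : ℂ)
  have hDinv := hDlim.inv₀ hπ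
  set T : ℤ × ℂ → ℂ := fun q => q.2 - b / 2 * (D q)⁻¹ with hT
  set x : ℤ × ℂ → ℂ := fun q => q.2 - b / (2 * Real.pi) with hx
  have hTx : Tendsto (fun q => T q - x q) l (𝓝 0) := by
    have h1 := (hDinv.const_mul (b / 2)).const_sub (b / (2 * Real.pi))
    have h2 : b / (2 * Real.pi) - b / 2 * (Real.pi : ℂ)⁻¹ = 0 := by field_simp; ring
    rw [h2] at h1
    refine h1.congr fun q => ?_
    simp only [hT, hx]; ring
  have hxO : x =O[l] fun _ => (1 : ℝ) := hw.sub (isBigO_const_const _ one_ne_zero _)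
  have hTO : T =O[l] fun _ => (1 : ℝ) := by
    simpa using ((hTx.isBigO_one ℝ).add hxO)
  have ht : Tendsto (fun q => T q * (q.1 : ℂ)⁻¹) l (𝓝 0) :=
    tendsto_mul_zero_of_isBigO_one hTO hinv
  have hsq : Tendsto (fun q => (T q + x q) * (T q - x q)) l (𝓝 0) :=
    tendsto_mul_zero_of_isBigO_one (hTO.add hxO) hTx
  -- The quartic Taylor remainder of the cosine at `T/n` is `O(n⁻⁴)`, which survives multiplication
  -- by `n²`.
  have hquart : Tendsto (fun q : ℤ × ℂ => (q.1 : ℂ) ^ 2 * (Complex.cos (T q * (q.1 : ℂ)⁻¹) -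
      (1 - (T q * (q.1 : ℂ)⁻¹) ^ 2 / 2))) l (𝓝 0) := by
    have h1 : Tendsto (fun q : ℤ × ℂ => T q ^ 2 * (T q * (q.1 : ℂ)⁻¹) ^ 2) l (𝓝 0) := by
      have h2 : (fun q => T q ^ 2) =O[l] fun _ => (1 : ℝ) := by simpa using hTO.pow 2
      exact tendsto_mul_zero_of_isBigO_one h2 (by simpa using ht.pow 2)
    have h1' := h1.norm
    rw [norm_zero] at h1'
    refine squeeze_zero_norm' ?_ h1'
    have h3 := ht.norm
    rw [norm_zero] at h3
    filter_upwards [h3.eventually_le_const one_pos, hn0] with q hq hq0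
    have h4 := Complex.cos_bound hq
    have h5 : 0 < ‖(q.1 : ℂ)‖ := norm_pos_iff.2 hq0
    rw [norm_mul, norm_pow]
    refine (mul_le_mul_of_nonneg_left h4 (by positivity)).trans ?_
    rw [norm_mul, norm_inv]
    have h6 : ‖(q.1 : ℂ)‖ ^ 2 * ((‖T q‖ * ‖(q.1 : ℂ)‖⁻¹) ^ 4 * (5 / 96)) =
        ‖T q‖ ^ 2 * (‖T q‖ * ‖(q.1 : ℂ)‖⁻¹) ^ 2 * (5 / 96) := by field_simp
    rw [h6]
    have h7 : 0 ≤ ‖T q‖ ^ 2 * (‖T q‖ * ‖(q.1 : ℂ)‖⁻¹) ^ 2 := by positivity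
    rw [norm_mul, norm_pow, norm_pow, norm_mul, norm_inv]
    linarith
  have hcosO : (fun q : ℤ × ℂ => Complex.cos (Real.pi * q.1)) =O[l] fun _ => (1 : ℝ) :=
    IsBigO.of_bound 1 (Eventually.of_forall fun q => by simp [norm_cos_pi_mul_int])
  have hmain := tendsto_mul_zero_of_isBigO_one hcosO
    (by simpa using hquart.sub (hsq.div_const 2))
  have hΔ : Tendsto (fun q : ℤ × ℂ => (q.1 : ℂ) ^ 2 * (Δ (Real.pi * q.1 + q.2 / q.1) -
      Complex.cos (Real.pi * q.1 + T q * (q.1 : ℂ)⁻¹))) l (𝓝 0) := by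
    rw [tendsto_zero_iff_norm_tendsto_zero, Metric.tendsto_nhds]
    intro ε hε
    have h1 := (tendsto_mul_zero_of_isBigO_one hw hinv).norm
    rw [norm_zero] at h1
    filter_upwards [tendsto_fst.eventually (h (ε / 2) (half_pos hε)), hn0,
      h1.eventually_le_const one_pos, hDlim.eventually_ne hπ] with q hq hq0 hq1 hqD
    have hz := hq (Real.pi * q.1 + q.2 / q.1) (by rwa [add_sub_cancel_left, div_eq_mul_inv])
    have h2 : (Real.pi * q.1 + q.2 / q.1 : ℂ) = q.1 * D q := by
      simp only [hD]; field_simp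
    have h3 : (Real.pi * q.1 + q.2 / q.1 : ℂ) - b / (2 * (Real.pi * q.1 + q.2 / q.1)) =
        Real.pi * q.1 + T q * (q.1 : ℂ)⁻¹ := by
      conv_lhs => rw [h2]
      conv_lhs => enter [1]; rw [← h2]
      simp only [hT]
      generalize D q = d at hqD
      field_simp
      ring
    rw [h3] at hz
    have h5 : 0 < ‖(q.1 : ℂ)‖ := norm_pos_iff.2 hq0
    have h6 : ((q.1 : ℝ)) ^ 2 = ‖(q.1 : ℂ)‖ ^ 2 := by
      rw [← Complex.ofReal_intCast, Complex.norm_real, Real.norm_eq_abs, sq_abs]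
    rw [h6, le_div_iff₀ (by positivity)] at hz
    rw [dist_zero_right, norm_norm, norm_mul, norm_pow, mul_comm]
    linarith
  have := hΔ.add hmain
  rw [add_zero] at this
  refine this.congr' ?_
  filter_upwards [hn0] with q hq0
  have hsin : Complex.sin (Real.pi * q.1) = 0 := sin_eq_zero_iff_exists_int.2 ⟨q.1, rfl⟩
  rw [Complex.cos_add, hsin]
  simp only [hx]
  generalize T q = t
  field_simp
  ring

section
variable {N : ℕ} {τ : Fin N → ℂ → ℂ} {b : Fin N → ℂ} {ω : Finset (Fin N)}

/-- The limiting zeros, at the scale `1 / n` around `π n`. -/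
noncomputable def limitZero (b : Fin N → ℂ) (i : (Fin N × Fin N) × Bool) : ℂ :=
  (b i.1.1 + b i.1.2) / (4 * Real.pi)

/-- The index set of the zeros near `π n`. -/
def zeroIndex (ω : Finset (Fin N)) : Finset ((Fin N × Fin N) × Bool) :=
  orderedPairs ω ×ˢ Finset.univ

lemma card_zeroIndex (ω : Finset (Fin N)) : (zeroIndex ω).card = ω.card * (ω.card - 1) := by
  rw [zeroIndex, Finset.card_product, ← card_orderedPairs, Finset.card_univ, Fintype.card_bool,
    mul_comm]

/-- The difference of the two limiting quadratics in `w` is linear, with slope `(b_j - b_k)/2π` and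
zero `(b_j + b_k)/4π`. Squaring removes the sign `cos πn` and makes each zero double, which the two
values of the `Bool` index record. -/
lemma exists_tendsto_resonanceFun (hb : ∀ j ∈ ω, ∀ k ∈ ω, j ≠ k → b j ≠ b k)
    (href : ∀ j ∈ ω, HasRefinedAsymptotics (lyapunov τ j) (b j)) :
    ∃ (k : ℕ) (C : ℂ), C ≠ 0 ∧ ∀ W : ℝ,
      Tendsto (fun q : ℤ × ℂ => (q.1 : ℂ) ^ k * resonanceFun τ ω (Real.pi * q.1 + q.2 / q.1) -
        C * ∏ i ∈ zeroIndex ω, (q.2 - limitZero b i))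
        (cofinite ×ˢ 𝓟 (Metric.closedBall (0 : ℂ) W)) (𝓝 0) := by
  have hπ : (Real.pi : ℂ) ≠ 0 := by exact_mod_cast Real.pi_ne_zero
  refine ⟨2 * ((orderedPairs ω).card * 2),
    ∏ p ∈ orderedPairs ω, ((b p.1 - b p.2) / (2 * Real.pi)) ^ 2, ?_, fun W => ?_⟩
  · refine Finset.prod_ne_zero_iff.2 fun p hp => pow_ne_zero _ (div_ne_zero (sub_ne_zero.2 ?_) ?_)
    · simp only [orderedPairs, Finset.mem_filter, Finset.mem_product] at hp
      exact hb _ hp.1.1 _ hp.1.2 hp.2.ne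
    · exact mul_ne_zero two_ne_zero hπ
  set l := (cofinite : Filter ℤ) ×ˢ 𝓟 (Metric.closedBall (0 : ℂ) W) with hl
  have hcosO : (fun q : ℤ × ℂ => Complex.cos (Real.pi * q.1)) =O[l] fun _ => (1 : ℝ) :=
    IsBigO.of_bound 1 (Eventually.of_forall fun q => by simp [norm_cos_pi_mul_int])
  obtain ⟨hO, ho⟩ := isLittleO_prod_sub_prod (l := l) (E := fun _ => (1 : ℝ)) (orderedPairs ω)
    (f := fun p q => Complex.cos (Real.pi * q.1) * ((b p.1 - b p.2) / (2 * Real.pi) *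
      (q.2 - (b p.1 + b p.2) / (4 * Real.pi))))
    (g := fun p q => (q.1 : ℂ) ^ 2 * (lyapunov τ p.1 (Real.pi * q.1 + q.2 / q.1) -
      lyapunov τ p.2 (Real.pi * q.1 + q.2 / q.1)))
    (fun p _ => by
      have h1 : (fun q : ℤ × ℂ => q.2 - (b p.1 + b p.2) / (4 * Real.pi)) =O[l]
          fun _ => (1 : ℝ) := (isBigO_snd W).sub (isBigO_const_const _ one_ne_zero _)
      simpa using hcosO.mul (h1.const_mul_left ((b p.1 - b p.2) / (2 * Real.pi))))
    (fun p hp => by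
      simp only [orderedPairs, Finset.mem_filter, Finset.mem_product] at hp
      rw [isLittleO_one_iff]
      have := ((href _ hp.1.1).tendsto W).sub ((href _ hp.1.2).tendsto W)
      rw [sub_zero] at this
      refine this.congr fun q => ?_
      field_simp
      ring)
  simp only [one_pow] at hO ho
  have hlim := tendsto_mul_zero_of_isBigO_one (ho.isBigO.add (hO.const_mul_left 2))
    ((isLittleO_one_iff ℝ).1 ho)
  refine hlim.congr fun q => ?_
  have h1 : (q.1 : ℂ) ^ (2 * ((orderedPairs ω).card * 2)) *
      resonanceFun τ ω (Real.pi * q.1 + q.2 / q.1) =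
      (∏ p ∈ orderedPairs ω, (q.1 : ℂ) ^ 2 * (lyapunov τ p.1 (Real.pi * q.1 + q.2 / q.1) -
      lyapunov τ p.2 (Real.pi * q.1 + q.2 / q.1))) ^ 2 := by
    rw [Finset.prod_mul_distrib, Finset.prod_const, mul_pow _ _ 2, resonanceFun, Finset.prod_pow,
      ← pow_mul, ← pow_mul]
  have h2 : (∏ p ∈ orderedPairs ω, ((b p.1 - b p.2) / (2 * Real.pi)) ^ 2) *
      ∏ i ∈ zeroIndex ω, (q.2 - limitZero b i) = (∏ p ∈ orderedPairs ω,
      Complex.cos (Real.pi * q.1) * ((b p.1 - b p.2) / (2 * Real.pi) *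
      (q.2 - (b p.1 + b p.2) / (4 * Real.pi)))) ^ 2 := by
    rw [zeroIndex, Finset.prod_product, ← Finset.prod_mul_distrib, ← Finset.prod_pow]
    refine Finset.prod_congr rfl fun p _ => ?_
    simp only [limitZero, Finset.prod_const, Finset.card_univ, Fintype.card_bool]
    rw [mul_pow (Complex.cos _), cos_pi_mul_int_sq, one_mul, mul_pow]
  rw [h1, h2]
  ring

end

section Near
variable {ι : Type*} {f : ℂ → ℂ}

lemma hasZeros_const_mul_prod [DecidableEq ι] {c C : ℂ} {R : ℝ} (hC : C ≠ 0) (S : Finset ι)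
    (a : ι → ℂ) (P : ι → Prop) [DecidablePred P]
    (h1 : ∀ i ∈ S, P i → a i ∈ Metric.ball c R) (h2 : ∀ i ∈ S, ¬ P i → a i ∉ Metric.closedBall c R) :
    HasZeros (fun z => C * ∏ i ∈ S, (z - a i)) c R ((S.filter P).val.map a) := by
  refine ⟨fun w hw => ?_, fun z => C * ∏ i ∈ S.filter fun i => ¬ P i, (z - a i), by fun_prop,
    fun z hz => mul_ne_zero hC (Finset.prod_ne_zero_iff.2 fun i hi h0 => ?_), fun z => ?_⟩
  · obtain ⟨i, hi, rfl⟩ := Multiset.mem_map.1 hw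
    obtain ⟨hi, hP⟩ := Finset.mem_filter.1 hi
    exact h1 i hi hP
  · obtain ⟨hi, hP⟩ := Finset.mem_filter.1 hi
    rw [sub_eq_zero.1 h0] at hz
    exact h2 i hi hP hz
  · rw [Multiset.map_map, ← Finset.prod_filter_mul_prod_filter_not S P]
    simp only [Function.comp_def, Finset.prod]
    ring

open scoped Classical in
/-- The number of zeros at distance `O(1/n)` from the limiting zero `π n + v / n`. -/
lemma eventually_exists_hasZeros_near (hf : Differentiable ℂ f) {S : Finset ι} {v : ι → ℂ}
    {k : ℕ} {C : ℂ} (hC : C ≠ 0)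
    (hlim : ∀ W : ℝ, Tendsto (fun q : ℤ × ℂ => (q.1 : ℂ) ^ k * f (Real.pi * q.1 + q.2 / q.1) -
        C * ∏ i ∈ S, (q.2 - v i)) (cofinite ×ˢ 𝓟 (Metric.closedBall (0 : ℂ) W)) (𝓝 0))
    {δ : ℝ} (hδ : 0 < δ) (hsep : ∀ i ∈ S, ∀ j ∈ S, v i ≠ v j → 2 * δ ≤ ‖v i - v j‖)
    {i : ι} (hi : i ∈ S) :
    ∀ᶠ n : ℤ in cofinite, ∃ Z, HasZeros f (Real.pi * n + v i / n) (δ / ‖(n : ℂ)‖) Z ∧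
      Multiset.card Z = (S.filter fun j => v j = v i).card := by
  have h1 := (hlim (‖v i‖ + δ)).norm
  rw [norm_zero] at h1
  -- On the circle every factor `w - v j` is at least `δ`: it equals `δ` in modulus if `v j = v i`,
  -- and otherwise the separation `2δ` applies. This bounds the comparison polynomial below.
  have h2 := h1.eventually_lt_const (show 0 < ‖C‖ * δ ^ S.card by
    have := norm_pos_iff.2 hC
    positivity)
  rw [eventually_prod_principal_iff] at h2
  filter_upwards [h2, eventually_cofinite_ne (0 : ℤ)] with n hn hn0
  have hnC : (n : ℂ) ≠ 0 := by exact_mod_cast hn0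
  have hnp : 0 < ‖(n : ℂ)‖ := norm_pos_iff.2 hnC
  have hR : 0 < δ / ‖(n : ℂ)‖ := by positivity
  have hfac : ∀ z j, n * (z - Real.pi * n) - v j = n * (z - (Real.pi * n + v j / n)) := by
    intro z j
    field_simp
    ring
  have hdist : ∀ z ∈ Metric.sphere (Real.pi * n + v i / n : ℂ) (δ / ‖(n : ℂ)‖),
      ‖n * (z - Real.pi * n) - v i‖ = δ := by
    intro z hz
    rw [mem_sphere_iff_norm] at hz
    rw [hfac, norm_mul, hz, mul_div_cancel₀ _ hnp.ne']
  have hQ := hasZeros_const_mul_prod (c := Real.pi * n + v i / n) (R := δ / ‖(n : ℂ)‖)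
    (mul_ne_zero hC (pow_ne_zero S.card hnC)) S (fun j => Real.pi * n + v j / n)
    (fun j => v j = v i) (fun j _ hj => by simpa [hj] using hR) (fun j hj hne => by
      have h3 := hsep j hj i hi hne
      rw [mem_closedBall_iff_norm, add_sub_add_left_eq_sub, ← sub_div, norm_div,
        div_le_div_iff_of_pos_right hnp]
      linarith)
  have hQeq : ∀ z, C * (n : ℂ) ^ S.card * ∏ j ∈ S, (z - (Real.pi * n + v j / n)) =
      C * ∏ j ∈ S, (n * (z - Real.pi * n) - v j) := by
    intro z
    simp only [hfac, Finset.prod_mul_distrib, Finset.prod_const]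
    ring
  have hlt : ∀ z ∈ Metric.sphere (Real.pi * n + v i / n : ℂ) (δ / ‖(n : ℂ)‖),
      ‖(n : ℂ) ^ k * f z - C * (n : ℂ) ^ S.card * ∏ j ∈ S, (z - (Real.pi * n + v j / n))‖ <
        ‖C * (n : ℂ) ^ S.card * ∏ j ∈ S, (z - (Real.pi * n + v j / n))‖ := by
    intro z hz
    have hd := hdist z hz
    rw [hQeq]
    have h3 := hn (n * (z - Real.pi * n)) (by
      rw [mem_closedBall_zero_iff]
      have := norm_sub_norm_le ((n : ℂ) * (z - Real.pi * n)) (v i)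
      linarith)
    rw [mul_div_cancel_left₀ _ hnC, add_sub_cancel] at h3
    refine h3.trans_le ?_
    rw [norm_mul, norm_prod]
    gcongr
    rw [← Finset.prod_const]
    refine Finset.prod_le_prod (fun _ _ => hδ.le) fun j hj => ?_
    rcases eq_or_ne (v i) (v j) with h | h
    · rw [← h, hd]
    · have h4 := hsep i hi j hj h
      have h5 := norm_sub_le (n * (z - Real.pi * n) - v j) (n * (z - Real.pi * n) - v i)
      rw [sub_sub_sub_cancel_left] at h5
      linarith
  obtain ⟨Z, hZ⟩ := exists_hasZeros hf hR fun z hz h0 => by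
    have := hlt z hz
    rw [h0, mul_zero, zero_sub, norm_neg] at this
    exact lt_irrefl _ this
  refine ⟨Z, hZ, ?_⟩
  have h6 := HasZeros.card_eq_of_norm_sub_lt hR ((HasZeros.const (pow_ne_zero k hnC)).mul hZ) hQ hlt
  rwa [Multiset.card_add, Multiset.card_zero, zero_add, Multiset.card_map] at h6

/-- Labelling the zeros in the disc `|z - π n| < π / 2` according to the limiting zeros. -/
lemma eventually_exists_map_eq_near (hf : Differentiable ℂ f) {S : Finset ι} {v : ι → ℂ}
    {k : ℕ} {C : ℂ} (hC : C ≠ 0)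
    (hlim : ∀ W : ℝ, Tendsto (fun q : ℤ × ℂ => (q.1 : ℂ) ^ k * f (Real.pi * q.1 + q.2 / q.1) -
        C * ∏ i ∈ S, (q.2 - v i)) (cofinite ×ˢ 𝓟 (Metric.closedBall (0 : ℂ) W)) (𝓝 0))
    {ε : ℝ} (hε : 0 < ε) :
    ∀ᶠ n : ℤ in cofinite, ∀ Z : Multiset ℂ, HasZeros f (Real.pi * n) (Real.pi / 2) Z →
      Multiset.card Z = S.card → ∃ Y : ι → ℂ, S.val.map Y = Z ∧
        ∀ i ∈ S, ‖Y i - (Real.pi * n + v i / n)‖ ≤ ε / ‖(n : ℂ)‖ := by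
  classical
  obtain ⟨δ, ⟨hsep, hδε⟩, hδ⟩ : ∃ δ : ℝ, ((∀ i ∈ S, ∀ j ∈ S, v i ≠ v j → 2 * δ ≤ ‖v i - v j‖) ∧
      δ ≤ ε) ∧ 0 < δ := by
    have h1 : ∀ᶠ δ : ℝ in 𝓝[>] 0, ∀ i ∈ S, ∀ j ∈ S, v i ≠ v j → 2 * δ ≤ ‖v i - v j‖ := by
      refine (Finset.eventually_all S).2 fun i _ => (Finset.eventually_all S).2 fun j _ => ?_
      by_cases hij : v i = v j
      · exact Eventually.of_forall fun δ h => absurd hij h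
      · have hp : 0 < ‖v i - v j‖ / 2 := half_pos (norm_pos_iff.2 (sub_ne_zero.2 hij))
        filter_upwards [nhdsWithin_le_nhds (eventually_le_nhds hp)] with δ hδ _
        linarith
    exact ((h1.and (nhdsWithin_le_nhds (eventually_le_nhds hε))).and self_mem_nhdsWithin).exists
  have h2 : ∀ᶠ n : ℤ in cofinite, ∀ i ∈ S, ∃ Z, HasZeros f (Real.pi * n + v i / n) (δ / ‖(n : ℂ)‖) Z ∧
      Multiset.card Z = (S.filter fun j => v j = v i).card :=
    (Finset.eventually_all S).2 fun i hi =>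
      eventually_exists_hasZeros_near hf hC hlim hδ hsep hi
  have hnorm : Tendsto (fun n : ℤ => ‖(n : ℂ)‖) cofinite atTop := by
    have := (tendsto_norm_cocompact_atTop (E := ℝ)).comp Int.tendsto_coe_cofinite
    refine this.congr fun n => ?_
    rw [Function.comp_apply, ← Complex.norm_real, Complex.ofReal_intCast]
  have h3 : ∀ᶠ n : ℤ in cofinite, ∀ i ∈ S, ‖v i‖ + δ < Real.pi / 2 * ‖(n : ℂ)‖ :=
    (Finset.eventually_all S).2 fun i _ =>
      (hnorm.const_mul_atTop (half_pos Real.pi_pos)).eventually_gt_atTop _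
  filter_upwards [h2, h3, eventually_cofinite_ne (0 : ℤ)] with n hn2 hn3 hn0 Z hZ hcard
  have hnC : (n : ℂ) ≠ 0 := by exact_mod_cast hn0
  have hnp : 0 < ‖(n : ℂ)‖ := norm_pos_iff.2 hnC
  have hdiff : ∀ i j, (Real.pi * n + v i / n) - (Real.pi * n + v j / n) = (v i - v j) / n := by
    intro i j; ring
  have hsepn : ∀ i ∈ S, ∀ j ∈ S, (Real.pi * n + v i / n : ℂ) ≠ Real.pi * n + v j / n →
      2 * (δ / ‖(n : ℂ)‖) ≤ ‖(Real.pi * n + v i / n : ℂ) - (Real.pi * n + v j / n)‖ := by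
    intro i hi j hj hne
    have hv : v i ≠ v j := by
      rintro h
      exact hne (by simp [h])
    rw [hdiff, norm_div, ← mul_div_assoc]
    exact div_le_div_of_nonneg_right (hsep i hi j hj hv) hnp.le
  have hcountn : ∀ i ∈ S,
      Multiset.card (Z.filter (· ∈ Metric.ball (Real.pi * n + v i / n : ℂ) (δ / ‖(n : ℂ)‖))) =
        (S.filter fun j => (Real.pi * n + v j / n : ℂ) = Real.pi * n + v i / n).card := by
    intro i hi
    obtain ⟨Z', hZ', hcard'⟩ := hn2 i hi
    -- The small disc lies in the large one, and both multisets count a point by the order of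
    -- vanishing of `f`.
    have h4 : Z.filter (· ∈ Metric.ball (Real.pi * n + v i / n : ℂ) (δ / ‖(n : ℂ)‖)) = Z' := by
      ext w
      rw [Multiset.count_filter]
      split_ifs with hw
      · have hw2 : w ∈ Metric.ball (Real.pi * n : ℂ) (Real.pi / 2) := by
          rw [mem_ball_iff_norm] at hw ⊢
          have h5 := norm_add_le (w - (Real.pi * n + v i / n)) (v i / n)
          rw [show w - (Real.pi * n + v i / n) + v i / n = w - Real.pi * n by ring, norm_div] at h5
          have h6 : (‖v i‖ + δ) / ‖(n : ℂ)‖ < Real.pi / 2 := by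
            rw [div_lt_iff₀ hnp]; exact hn3 i hi
          rw [add_div] at h6
          linarith
        have h7 := hZ.analyticOrderAt_eq (Metric.ball_subset_closedBall hw2)
        have h8 := hZ'.analyticOrderAt_eq (Metric.ball_subset_closedBall hw)
        rw [h7] at h8
        exact_mod_cast h8
      · exact (Multiset.count_eq_zero_of_notMem fun h => hw (hZ'.mem_ball w h)).symm
    have h9 : ∀ j, (Real.pi * n + v j / n : ℂ) = Real.pi * n + v i / n ↔ v j = v i := by
      intro j
      rw [add_right_inj, div_left_inj' hnC]
    rw [h4, hcard']
    simp only [h9]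
  obtain ⟨Y, hY, hnear⟩ := exists_map_eq_near S hcard (fun i => (Real.pi * n + v i / n : ℂ))
    hsepn (by convert hcountn)
  refine ⟨Y, hY, fun i hi => (hnear i hi).le.trans ?_⟩
  gcongr

end Near

/-! ### Assembling the global labelling, and the theorem. -/

/-- A labelling of the zeros of `f`, given their numbers in the discs, which is as close as possible
to the points `β n i` in the distant discs. -/
lemma exists_listsZeros {N : ℕ} {ω : Finset (Fin N)} {f : ℂ → ℂ} (hfd : Differentiable ℂ f)
    {n₀ : ℕ} {Z₀ : Multiset ℂ} (hZ₀ : HasZeros f 0 (Real.pi * (n₀ + 1 / 2)) Z₀)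
    (hcard : Multiset.card Z₀ = 2 * (zeroIndex ω).card * n₀) {Z : ℤ → Multiset ℂ}
    (hZ : ∀ n : ℤ, (n₀ : ℤ) < |n| → HasZeros f (Real.pi * n) (Real.pi / 2) (Z n))
    (hZcard : ∀ n : ℤ, (n₀ : ℤ) < |n| → Multiset.card (Z n) = (zeroIndex ω).card)
    (hloc : ∀ z : ℂ, f z = 0 → ‖z‖ < Real.pi * (n₀ + 1 / 2) ∨
        ∃ n : ℤ, (n₀ : ℤ) < |n| ∧ ‖z - Real.pi * n‖ < Real.pi / 2)
    (β : ℤ → (Fin N × Fin N) × Bool → ℂ) :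
    ∃ ζ : Fin N × Fin N → Bool → ℤ → ℂ, ListsZeros ω f ζ ∧
      ∀ n : ℤ, (n₀ : ℤ) < |n| → (zeroIndex ω).val.map (fun i => ζ i.1 i.2 n) = Z n ∧
        ∀ Y' : (Fin N × Fin N) × Bool → ℂ, (zeroIndex ω).val.map Y' = Z n → ∀ r : ℝ, 0 ≤ r →
          (∀ i ∈ zeroIndex ω, ‖Y' i - β n i‖ ≤ r) →
          ∀ i ∈ zeroIndex ω, ‖ζ i.1 i.2 n - β n i‖ ≤ r := by
  classical
  have hπ := Real.pi_pos
  have hex : ∀ n : ℤ, ∃ Y : (Fin N × Fin N) × Bool → ℂ, (n₀ : ℤ) < |n| →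
      (zeroIndex ω).val.map Y = Z n ∧
        ∀ Y' : (Fin N × Fin N) × Bool → ℂ, (zeroIndex ω).val.map Y' = Z n → ∀ r : ℝ, 0 ≤ r →
          (∀ i ∈ zeroIndex ω, ‖Y' i - β n i‖ ≤ r) →
          ∀ i ∈ zeroIndex ω, ‖Y i - β n i‖ ≤ r := by
    intro n
    by_cases hn : (n₀ : ℤ) < |n|
    · obtain ⟨Y, hY⟩ := exists_map_eq_and_closest (zeroIndex ω) (hZcard n hn) (β n)
      exact ⟨Y, fun _ => hY⟩
    · exact ⟨0, fun h => absurd h hn⟩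
  choose Y hY using hex
  -- The zeros in the central disc are distributed arbitrarily over the `2n₀` nonzero indices that
  -- own no distant disc; the counts match exactly.
  set T : Finset ℤ := (Finset.Icc (-n₀ : ℤ) n₀).erase 0 with hT
  have hTmem : ∀ n : ℤ, n ∈ T ↔ n ≠ 0 ∧ ¬ (n₀ : ℤ) < |n| := by
    intro n
    rw [hT, Finset.mem_erase, Finset.mem_Icc, ← abs_le, not_lt]
  have hTcard : T.card = 2 * n₀ := by
    rw [hT, Finset.card_erase_of_mem (by simp), Int.card_Icc]
    omega
  obtain ⟨W, hW⟩ := exists_map_eq_of_card_eq (zeroIndex ω ×ˢ T) (Z := Z₀) (by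
    rw [hcard, Finset.card_product, hTcard]; ring)
  have hfar : ∀ (n : ℤ) (z : ℂ), (n₀ : ℤ) < |n| → ‖z - Real.pi * n‖ < Real.pi / 2 →
      ¬ ‖z‖ < Real.pi * (n₀ + 1 / 2) := by
    intro n z hn hz hlt
    have h5 : (n₀ : ℝ) + 1 ≤ ((|n| : ℤ) : ℝ) := by exact_mod_cast hn
    have h6 := norm_sub_norm_le (Real.pi * n : ℂ) z
    rw [norm_sub_rev, norm_pi_mul_int] at h6
    nlinarith
  have huniq : ∀ (n k : ℤ) (z : ℂ), ‖z - Real.pi * n‖ < Real.pi / 2 →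
      ‖z - Real.pi * k‖ < Real.pi / 2 → n = k := by
    intro n k z hn hk
    by_contra hne
    have h7 := pi_le_norm_pi_mul_int_sub hne
    have h8 := norm_sub_le (z - Real.pi * k) (z - Real.pi * n)
    rw [sub_sub_sub_cancel_left] at h8
    linarith
  have hYmem : ∀ n : ℤ, (n₀ : ℤ) < |n| → ∀ i ∈ zeroIndex ω, ‖Y n i - Real.pi * n‖ < Real.pi / 2 := by
    intro n hn i hi
    refine mem_ball_iff_norm.1 ((hZ n hn).mem_ball _ ?_)
    rw [← (hY n hn).1]
    exact Multiset.mem_map_of_mem _ hi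
  have hWmem : ∀ q ∈ zeroIndex ω ×ˢ T, ‖W q‖ < Real.pi * (n₀ + 1 / 2) := by
    intro q hq
    refine mem_ball_zero_iff.1 (hZ₀.mem_ball _ ?_)
    rw [← hW]
    exact Multiset.mem_map_of_mem _ hq
  have hidx : ∀ i : (Fin N × Fin N) × Bool, i ∈ zeroIndex ω ↔ i.1 ∈ orderedPairs ω := by
    intro i; simp [zeroIndex]
  refine ⟨fun p σ n => if (n₀ : ℤ) < |n| then Y n (p, σ) else W ((p, σ), n), fun w => ?_,
    fun n hn => ?_⟩
  · rcases em (f w = 0) with hw0 | hw0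
    · rcases hloc w hw0 with hw | ⟨n, hn, hw⟩
      · have h1 : {q : (Fin N × Fin N) × Bool × ℤ | q.1 ∈ orderedPairs ω ∧ q.2.2 ≠ 0 ∧
            (if (n₀ : ℤ) < |q.2.2| then Y q.2.2 (q.1, q.2.1) else W ((q.1, q.2.1), q.2.2)) = w} =
            (((zeroIndex ω ×ˢ T).filter fun q => w = W q).map
              (Equiv.prodAssoc _ _ _).toEmbedding : Finset _) := by
          ext ⟨p, σ, n⟩
          simp only [Set.mem_ofPred_eq, Finset.coe_map, Set.mem_image_equiv,
            Equiv.coe_toEmbedding, Finset.mem_coe, Finset.mem_filter, Finset.mem_product,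
            Equiv.prodAssoc_symm_apply, hidx, hTmem]
          constructor
          · rintro ⟨hp, hn, h⟩
            split_ifs at h with hlt
            · exact absurd hw (h ▸ hfar n _ hlt (hYmem n hlt _ ((hidx _).2 hp)))
            · exact ⟨⟨hp, hn, hlt⟩, h.symm⟩
          · rintro ⟨⟨hp, hn, hlt⟩, h⟩
            exact ⟨hp, hn, by rw [if_neg hlt, h]⟩
        rw [h1, Set.encard_coe_eq_coe_finsetCard, Finset.card_map,
          hZ₀.analyticOrderAt_eq (by simpa using hw.le), ← hW, Multiset.count_map]
        rfl
      · have h1 : {q : (Fin N × Fin N) × Bool × ℤ | q.1 ∈ orderedPairs ω ∧ q.2.2 ≠ 0 ∧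
            (if (n₀ : ℤ) < |q.2.2| then Y q.2.2 (q.1, q.2.1) else W ((q.1, q.2.1), q.2.2)) = w} =
            (((zeroIndex ω).filter fun i => w = Y n i).map
              ⟨fun i => (i.1, i.2, n), fun i j h => by
                simp only [Prod.mk.injEq] at h
                exact Prod.ext h.1 h.2.1⟩ : Finset _) := by
          ext ⟨p, σ, k⟩
          simp only [Set.mem_ofPred_eq, Finset.coe_map, Set.mem_image, Finset.mem_coe,
            Finset.mem_filter, hidx]
          constructor
          · rintro ⟨hp, hk, h⟩
            split_ifs at h with hlt
            · have h2 := hYmem k hlt _ ((hidx (p, σ)).2 hp)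
              rw [h] at h2
              obtain rfl := huniq _ _ _ hw h2
              exact ⟨(p, σ), ⟨hp, h.symm⟩, rfl⟩
            · have h2 := hWmem ((p, σ), k)
                (Finset.mem_product.2 ⟨(hidx _).2 hp, (hTmem k).2 ⟨hk, hlt⟩⟩)
              rw [h] at h2
              exact absurd h2 (hfar n w hn hw)
          · rintro ⟨i, ⟨hi, h⟩, heq⟩
            obtain ⟨rfl, rfl, rfl⟩ : i.1 = p ∧ i.2 = σ ∧ n = k := by
              change (i.1, i.2, n) = (p, σ, k) at heq
              simpa using heq
            refine ⟨hi, ?_, by rw [if_pos hn, h]⟩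
            rintro rfl
            simp only [abs_zero] at hn
            omega
        rw [h1, Set.encard_coe_eq_coe_finsetCard, Finset.card_map,
          (hZ n hn).analyticOrderAt_eq (by rw [mem_closedBall_iff_norm]; exact hw.le),
          ← (hY n hn).1, Multiset.count_map]
        rfl
    · rw [((hfd.analyticAt w).analyticOrderAt_eq_zero).2 hw0, eq_comm, Set.encard_eq_zero,
        Set.eq_empty_iff_forall_notMem]
      rintro ⟨p, σ, n⟩ ⟨hp, hn, h⟩
      refine hw0 ?_
      rw [← h]
      simp only
      split_ifs with hlt
      · refine ((hZ n hlt).eq_zero_iff ?_).2 ?_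
        · rw [mem_closedBall_iff_norm]
          exact (hYmem n hlt _ ((hidx (p, σ)).2 hp)).le
        · rw [← (hY n hlt).1]
          exact Multiset.mem_map_of_mem _ ((hidx (p, σ)).2 hp)
      · have hq : ((p, σ), n) ∈ zeroIndex ω ×ˢ T :=
          Finset.mem_product.2 ⟨(hidx _).2 hp, (hTmem n).2 ⟨hn, hlt⟩⟩
        refine (hZ₀.eq_zero_iff ?_).2 ?_
        · simpa using (hWmem _ hq).le
        · rw [← hW]
          exact Multiset.mem_map_of_mem _ hq
  · simp only [if_pos hn]
    exact hY n hn

theorem lemma2p3 {N N₀ : ℕ} (hN : 2 ≤ N)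
    (M : ℂ → Matrix (Fin N) (Fin N) ℂ) (hM : IsMonodromyZero M)
    (τ : Fin N → ℂ → ℂ) (ω : Fin N₀ → Finset (Fin N))
    (Φ : Fin N₀ → Polynomial entireFunctions)
    (hdec : IsLyapunovDecomposition M τ ω Φ)
    (s : Fin N₀) (b : Fin N → ℂ)
    (hb : ∀ j ∈ ω s, ∀ k ∈ ω s, j ≠ k → b j ≠ b k)
    (hasymp : ∀ j ∈ ω s, HasLyapunovAsymptotics imAtTop (lyapunov τ j) (b j)) :
    -- the Cartwright class and the asymptotics as `Im z → ∞`
    IsCartwright ((ω s).card * ((ω s).card - 1) : ℝ) ((ω s).card * ((ω s).card - 1) : ℝ)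
      (resonanceFun τ (ω s)) ∧
    (∃ ε : ℂ → ℂ, Tendsto ε imAtTop (𝓝 0) ∧
      ∀ᶠ z in imAtTop, resonanceFun τ (ω s) z =
        resonanceConst b (ω s) *
          (Complex.sin z / (2 * z)) ^ ((ω s).card * ((ω s).card - 1)) * (1 + ε z)) ∧
    ((∀ j ∈ ω s, HasLyapunovAsymptotics (cocompact ℂ) (lyapunov τ j) (b j)) →
      -- i) counting of the zeros
      (∃ n₀ : ℕ, 1 ≤ n₀ ∧
        HasRootCount (resonanceFun τ (ω s)) {z | ‖z‖ < Real.pi * (n₀ + 1 / 2)}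
          (2 * ((ω s).card * ((ω s).card - 1)) * n₀) ∧
        (∀ n : ℤ, (n₀ : ℤ) < |n| →
          HasRootCount (resonanceFun τ (ω s)) {z | ‖z - Real.pi * n‖ < Real.pi / 2}
            ((ω s).card * ((ω s).card - 1))) ∧
        (∀ z : ℂ, resonanceFun τ (ω s) z = 0 → ‖z‖ < Real.pi * (n₀ + 1 / 2) ∨
          ∃ n : ℤ, (n₀ : ℤ) < |n| ∧ ‖z - Real.pi * n‖ < Real.pi / 2)) ∧
      -- the asymptotics as `|z| → ∞`
      (∃ ε : ℂ → ℂ, ε =o[cocompact ℂ] (fun z => Real.exp |z.im|) ∧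
        ∀ᶠ z in cocompact ℂ, resonanceFun τ (ω s) z =
          resonanceConst b (ω s) *
            ((Complex.sin z + ε z) / (2 * z)) ^ ((ω s).card * ((ω s).card - 1))) ∧
      -- ii) labelling of the zeros, and iii) its refinement
      (∃ ζ : Fin N × Fin N → Bool → ℤ → ℂ,
        ListsZeros (ω s) (resonanceFun τ (ω s)) ζ ∧
        (∀ p ∈ orderedPairs (ω s), ∀ σ : Bool,
          Tendsto (fun n : ℤ => ζ p σ n - Real.pi * n) cofinite (𝓝 0)) ∧
        ((∀ j ∈ ω s, HasRefinedAsymptotics (lyapunov τ j) (b j)) →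
          ∀ p ∈ orderedPairs (ω s), ∀ σ : Bool,
            ∃ ε : ℤ → ℂ, Tendsto ε cofinite (𝓝 0) ∧
              ∀ n : ℤ, n ≠ 0 →
                ζ p σ n = Real.pi * n + (b p.1 + b p.2 + ε n) / (4 * Real.pi * n)))) := by
  refine ⟨isCartwright_resonanceFun hM hdec s hb hasymp,
    resonanceFun_asymptotics_imAtTop hb hasymp, fun hcoc => ?_⟩
  have hfd := differentiable_resonanceFun hdec s
  have hl : ∀ᶠ z in cocompact ℂ, z ≠ (0 : ℂ) :=
    (isCompact_singleton (x := (0 : ℂ))).compl_mem_cocompact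
  have hlittle := isLittleO_resonanceFun_sub hl hb hcoc
  obtain ⟨n₀, hn₀, ⟨Z₀, hZ₀, hcard⟩, hZ, hloc⟩ :=
    exists_zero_count hfd (resonanceConst_ne_zero hb) hlittle
  refine ⟨⟨n₀, hn₀, ?_, fun n hn => ?_, hloc⟩,
    resonanceFun_asymptotics_cocompact hb hcoc, ?_⟩
  · rw [← hcard]
    convert hZ₀.hasRootCount using 1
    ext z; simp
  · obtain ⟨Z, hZn, hZc⟩ := hZ n hn
    rw [← hZc]
    convert hZn.hasRootCount using 1
    ext z; simp [dist_eq_norm]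
  · have hex : ∀ n : ℤ, ∃ Z : Multiset ℂ, (n₀ : ℤ) < |n| →
        HasZeros (resonanceFun τ (ω s)) (Real.pi * n) (Real.pi / 2) Z ∧
          Multiset.card Z = (ω s).card * ((ω s).card - 1) := by
      intro n
      by_cases hn : (n₀ : ℤ) < |n|
      · obtain ⟨Z, h⟩ := hZ n hn
        exact ⟨Z, fun _ => h⟩
      · exact ⟨0, fun h => absurd h hn⟩
    choose Z hZn using hex
    -- The labelling is fixed before the refined asymptotics are assumed. For ii) only membership in
    -- the discs matters. For iii) it is at least as close to the predicted zeros as the labelling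
    -- found for any given `δ`.
    obtain ⟨ζ, hlist, hζ⟩ := exists_listsZeros (ω := ω s) hfd hZ₀ (by rw [hcard, card_zeroIndex])
      (fun n hn => (hZn n hn).1) (fun n hn => by rw [(hZn n hn).2, card_zeroIndex]) hloc
      (fun n i => Real.pi * n + limitZero b i / n)
    have hlarge : ∀ᶠ n : ℤ in cofinite, (n₀ : ℤ) < |n| := by
      have h1 := (Set.finite_Icc (-n₀ : ℤ) n₀).compl_mem_cofinite
      filter_upwards [h1] with n hn
      rw [Set.mem_compl_iff, Set.mem_Icc, ← abs_le] at hn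
      exact not_le.1 hn
    have hidx : ∀ {p}, p ∈ orderedPairs (ω s) → ∀ σ : Bool, (p, σ) ∈ zeroIndex (ω s) := by
      intro p hp σ; simpa [zeroIndex] using hp
    refine ⟨ζ, hlist, fun p hp σ => ?_, fun href p hp σ => ?_⟩
    · rw [Metric.tendsto_nhds]
      intro δ hδ
      filter_upwards [hlarge, eventually_norm_sub_lt_of_zero hlittle hδ] with n hn hnδ
      have hmem : ζ p σ n ∈ Z n := by
        rw [← (hζ n hn).1]
        exact Multiset.mem_map_of_mem (fun i : (Fin N × Fin N) × Bool => ζ i.1 i.2 n) (hidx hp σ)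
      have hball := (hZn n hn).1.mem_ball _ hmem
      rw [dist_zero_right]
      exact hnδ _ (((hZn n hn).1.eq_zero_iff (Metric.ball_subset_closedBall hball)).2 hmem)
        (mem_ball_iff_norm.1 hball)
    · obtain ⟨k, C, hC, hlim⟩ := exists_tendsto_resonanceFun hb href
      have hπ : (Real.pi : ℂ) ≠ 0 := by exact_mod_cast Real.pi_ne_zero
      refine ⟨fun n => 4 * Real.pi * n * (ζ p σ n - (Real.pi * n + limitZero b (p, σ) / n)), ?_,
        fun n hn => ?_⟩
      · rw [Metric.tendsto_nhds]
        intro δ hδ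
        -- Multiplication by `4π|n|` turns the error `δ/(8π|n|)` into `δ/2`.
        have hε : 0 < δ / (8 * Real.pi) := by have := Real.pi_pos; positivity
        filter_upwards [hlarge, eventually_exists_map_eq_near hfd hC hlim hε,
          eventually_cofinite_ne (0 : ℤ)] with n hn hnear hn0
        have hnp : 0 < ‖(n : ℂ)‖ := norm_pos_iff.2 (by exact_mod_cast hn0)
        obtain ⟨Y, hY, hYnear⟩ := hnear (Z n) (hZn n hn).1 (by rw [(hZn n hn).2, card_zeroIndex])
        have h1 := (hζ n hn).2 Y hY _ (by positivity) hYnear _ (hidx hp σ)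
        rw [dist_zero_right, norm_mul, norm_mul, norm_mul, Complex.norm_ofNat, Complex.norm_real,
          Real.norm_of_nonneg Real.pi_pos.le]
        have h2 : 4 * Real.pi * ‖(n : ℂ)‖ * (δ / (8 * Real.pi) / ‖(n : ℂ)‖) = δ / 2 := by
          have := Real.pi_ne_zero
          field_simp
          norm_num
        have h3 : 0 ≤ 4 * Real.pi * ‖(n : ℂ)‖ := by have := Real.pi_pos; positivity
        have h4 := mul_le_mul_of_nonneg_left h1 h3
        rw [h2] at h4
        exact h4.trans_lt (half_lt_self hδ)
      · have hnC : (n : ℂ) ≠ 0 := by exact_mod_cast hn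
        simp only [limitZero]
        field_simp
        ring
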